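/- **Noncommutative separation theorem.** Let $E=(E_*)^*$ be a dual operator space with distinguished predual $E_*$ (a complete operator space), and fix an infinite cardinal $\kappa$. For nonzero cardinals $m,n\le\kappa$ let $H_n$ be a Hilbert space of dimension $n$, let $\mathcal M_{m,n}=\mathcal B(H_n,H_m)$ and $\mathcal M_n=\mathcal M_{n,n}$, and identify $\mathcal M_n(E)$, the space of $n\times n$ matrices over $E$ with uniformly bounded finite submatrices, with the space $\mathrm{CB}(E_*,\mathcal M_n)$ of completely bounded maps, equipped with the point-weak* topology. A closed nc convex set over $E$ is a graded set $K=\coprod_{n\le\kappa}K_n$ with $K_n\subseteq\mathcal M_n(E)$ closed for every $n$, such that (1) $\sum_i\alpha_i x_i\alpha_i^*\in K_n$ for every bounded family $\{x_i\in K_{n_i}\}$ and every family of isometries $\{\alpha_i\in\mathcal M_{n,n_i}\}$ with $\sum_i\alpha_i\alpha_i^*=1_n$ (sums converging in the point-weak* topology), and (2) $\beta^*x\beta\in K_m$ for every $x\in K_n$ and every isometry $\beta\in\mathcal M_{n,m}$. For a completely bounded linear map $\phi:E\to\mathcal M_n$ and $x=[x_{ij}]\in\mathcal M_p(E)$ let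 $\phi_p(x)=[\phi(x_{ij})]\in\mathcal M_p(\mathcal M_n)=\mathcal B(H_p\otimes H_n)$. Let $K$ be a closed nc convex set over $E$ with $0_E\in K_1$, and let $y\in\mathcal M_n(E)$ with $y\notin K_n$, where $n\le\kappa$ is a nonzero cardinal, finite or infinite. Then there is a normal (that is, weak*-to-weak* continuous) completely bounded linear map $\phi:E\to\mathcal M_n$ such that $$\operatorname{Re}\phi_n(y)\not\le 1_n\otimes 1_n\quad\text{but}\quad \operatorname{Re}\phi_p(x)\le 1_p\otimes 1_n$$ for all nonzero $p\le\kappa$ and all $x\in K_p$. Moreover, if $E$ is an operator system (that is, $E$ is completely isometrically identified with a unital self-adjoint subspace of a unital C*-algebra) and $K\cup\{y\}$ consists of self-adjoint elements, where $(x^*)_{ij}=(x_{ji})^*$, then $\phi$ can be chosen self-adjoint, that is, $\phi(e^*)=\phi(e)^*$ for all $e\in E$. -/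

import Mathlib

open scoped Cardinal

universe u v w

/-! ## Operator spaces -/

/-- A family of real-valued functions, one on each `M_m(E)`. -/
abbrev MatrixNorm (E : Type*) : Type _ := ∀ m : ℕ, Matrix (Fin m) (Fin m) E → ℝ

/-- The product `α x β` of `x ∈ M_m(E)` with rectangular scalar matrices. -/
def scalarConj {E : Type*} [AddCommMonoid E] [Module ℂ E] {k m : ℕ}
    (α : Matrix (Fin k) (Fin m) ℂ) (x : Matrix (Fin m) (Fin m) E)
    (β : Matrix (Fin m) (Fin k) ℂ) : Matrix (Fin k) (Fin k) E :=
  fun i j => ∑ a, ∑ b, (α i a * β b j) • x a b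

/-- The block diagonal matrix `x ⊕ y ∈ M_{m+k}(E)`. -/
def blockSum {E : Type*} [Zero E] {m k : ℕ} (x : Matrix (Fin m) (Fin m) E)
    (y : Matrix (Fin k) (Fin k) E) : Matrix (Fin (m + k)) (Fin (m + k)) E :=
  (Matrix.fromBlocks x 0 0 y).submatrix finSumFinEquiv.symm finSumFinEquiv.symm

open scoped Matrix.Norms.L2Operator in
/-- An (abstract) operator space structure on a complex normed space: norms on all the matrix
spaces `M_m(E)`, extending the norm of `E = M_1(E)` and satisfying Ruan's axioms. Scalar matrices
carry their operator norm. -/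
class OperatorSpace (E : Type*) [NormedAddCommGroup E] [NormedSpace ℂ E] where
  mnorm : MatrixNorm E
  mnorm_one : ∀ e : E, mnorm 1 (fun _ _ => e) = ‖e‖
  mnorm_add_le : ∀ (m : ℕ) (x y : Matrix (Fin m) (Fin m) E),
    mnorm m (x + y) ≤ mnorm m x + mnorm m y
  mnorm_smul : ∀ (m : ℕ) (c : ℂ) (x : Matrix (Fin m) (Fin m) E),
    mnorm m (c • x) = ‖c‖ * mnorm m x
  mnorm_blockSum : ∀ (m k : ℕ) (x : Matrix (Fin m) (Fin m) E) (y : Matrix (Fin k) (Fin k) E),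
    mnorm (m + k) (blockSum x y) = max (mnorm m x) (mnorm k y)
  mnorm_scalarConj_le : ∀ (k m : ℕ) (α : Matrix (Fin k) (Fin m) ℂ)
    (x : Matrix (Fin m) (Fin m) E) (β : Matrix (Fin m) (Fin k) ℂ),
    mnorm k (scalarConj α x β) ≤ ‖α‖ * mnorm m x * ‖β‖

/-- The matrix norms of a C*-algebra `A`: `M_m(A)` carries its unique C*-norm. -/
noncomputable def cstarMatrixNorm (A : Type*) [CStarAlgebra A] [PartialOrder A]
    [StarOrderedRing A] : MatrixNorm A :=
  fun _ x => ‖CStarMatrix.ofMatrix x‖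

/-- `‖u_m(x)‖ ≤ C ‖x‖` for all `m` and `x ∈ M_m(E)`, that is `‖u‖_cb ≤ C` when `C ≥ 0`. -/
def CBBound {E F : Type*} [AddCommMonoid E] [Module ℂ E] [AddCommMonoid F] [Module ℂ F]
    (NE : MatrixNorm E) (NF : MatrixNorm F) (C : ℝ) (u : E →ₗ[ℂ] F) : Prop :=
  ∀ (m : ℕ) (x : Matrix (Fin m) (Fin m) E), NF m (x.map u) ≤ C * NE m x

/-- Complete boundedness of a linear map. -/
def CompletelyBounded {E F : Type*} [AddCommMonoid E] [Module ℂ E] [AddCommMonoid F]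
    [Module ℂ F] (NE : MatrixNorm E) (NF : MatrixNorm F) (u : E →ₗ[ℂ] F) : Prop :=
  ∃ C : ℝ, CBBound NE NF C u

/-! ## Hilbert spaces and the weak* topology of `B(H)` -/

/-- The Hilbert space `ℓ²(I)`, of dimension `#I`. The space `M_{I,J}` of scalar matrices is
`Hil J →L[ℂ] Hil I`. -/
abbrev Hil (I : Type*) : Type _ := lp (fun _ : I => ℂ) 2

/-- `M_I = B(ℓ²(I))`. -/
abbrev MM (I : Type*) : Type _ := Hil I →L[ℂ] Hil I

/-- The weak* (ultraweak) topology of `B(H)` as the dual of the trace class operators: the coarsest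
topology for which `T ↦ ∑ k, ⟪ξ k, T (η k)⟫` is continuous for all square summable sequences
`ξ`, `η` in `H`. -/
@[reducible]
noncomputable def weakStarTopology (H : Type*) [NormedAddCommGroup H] [InnerProductSpace ℂ H] :
    TopologicalSpace (H →L[ℂ] H) :=
  ⨅ (ξ : lp (fun _ : ℕ => H) 2) (η : lp (fun _ : ℕ => H) 2),
    TopologicalSpace.induced (fun T : H →L[ℂ] H => ∑' k : ℕ, inner ℂ (ξ k) (T (η k)))
      inferInstance

/-- Unconditional convergence `∑ i, f i = a` in the weak* topology of `B(H)`. -/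
def WeakStarHasSum {H : Type*} [NormedAddCommGroup H] [InnerProductSpace ℂ H] {ι : Type*}
    (f : ι → (H →L[ℂ] H)) (a : H →L[ℂ] H) : Prop :=
  Filter.Tendsto (fun s : Finset ι => ∑ i ∈ s, f i) Filter.atTop
    (@nhds (H →L[ℂ] H) (weakStarTopology H) a)

/-! ## The dual operator space `E = V*` and the spaces `M_I(E)`

A dual operator space is `E = V*` for a complete operator space `V`, its distinguished predual;
its elements are the bounded functionals on `V`. -/

/-- The linear map `V → M_m = B(ℂ^m)`, `v ↦ [f_ij(v)]`, given by `[f_ij] ∈ M_m(V*)`. -/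
noncomputable def evalMatrix {V : Type*} [NormedAddCommGroup V] [NormedSpace ℂ V] {m : ℕ}
    (f : Matrix (Fin m) (Fin m) (StrongDual ℂ V)) :
    V →ₗ[ℂ] (EuclideanSpace ℂ (Fin m) →L[ℂ] EuclideanSpace ℂ (Fin m)) where
  toFun v := Matrix.toEuclideanCLM (n := Fin m) (𝕜 := ℂ) (Matrix.of fun i j => f i j v)
  map_add' v₁ v₂ := by
    rw [← map_add]; congr 1; ext i j; simp
  map_smul' c v := by
    rw [RingHom.id_apply, ← map_smul]; congr 1; ext i j; simp

/-- The operator space structure of `V*`: the norm of `[f_ij] ∈ M_m(V*)` is the completely bounded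
norm of `v ↦ [f_ij(v)]`, so that `M_m(V*) = CB(V, M_m)`. -/
noncomputable def dualMatrixNorm (V : Type*) [NormedAddCommGroup V] [NormedSpace ℂ V]
    [OperatorSpace V] : MatrixNorm (StrongDual ℂ V) :=
  fun _ f => sInf {C : ℝ | 0 ≤ C ∧
    CBBound (OperatorSpace.mnorm (E := V)) (cstarMatrixNorm _) C (evalMatrix f)}

/-- `M_I(E)` for `E = V*` and an arbitrary index set `I`, identified with `CB(V, M_I)`. -/
def CBMatrix (V : Type v) [NormedAddCommGroup V] [NormedSpace ℂ V] [OperatorSpace V]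
    (I : Type u) : Type (max u v) :=
  {x : V →ₗ[ℂ] MM I //
    CompletelyBounded (OperatorSpace.mnorm (E := V)) (cstarMatrixNorm (MM I)) x}

namespace CBMatrix

variable {V : Type v} [NormedAddCommGroup V] [NormedSpace ℂ V] [OperatorSpace V] {I : Type u}

/-- The completely bounded map `V → M_I` that `x ∈ M_I(E)` is. -/
def toMap (x : CBMatrix V I) : V →ₗ[ℂ] MM I := x.1

/-- `‖x‖ ≤ C` in `M_I(E)`. -/
def NormLe (x : CBMatrix V I) (C : ℝ) : Prop :=
  CBBound (OperatorSpace.mnorm (E := V)) (cstarMatrixNorm (MM I)) C x.toMap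

noncomputable instance : Zero (CBMatrix V I) :=
  ⟨⟨0, 0, fun m x => by
    have h : x.map (0 : V →ₗ[ℂ] MM I) = 0 := by ext i j; rfl
    rw [h]
    simp [cstarMatrixNorm]⟩⟩

/-- The point-weak* topology on `M_I(E) = CB(V, M_I)`. -/
noncomputable instance : TopologicalSpace (CBMatrix V I) :=
  ⨅ v : V, TopologicalSpace.induced (fun x : CBMatrix V I => x.toMap v) (weakStarTopology (Hil I))

theorem exists_bound (x : CBMatrix V I) : ∃ C : ℝ, ∀ v, ‖x.toMap v‖ ≤ C * ‖v‖ := by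
  obtain ⟨C, hC⟩ := x.2
  refine ⟨C, fun v => ?_⟩
  have h := hC 1 (fun _ _ => v)
  rw [OperatorSpace.mnorm_one] at h
  refine le_trans ?_ h
  exact CStarMatrix.norm_entry_le_norm
    (M := CStarMatrix.ofMatrix (Matrix.map (m := Fin 1) (n := Fin 1) (fun _ _ => v) x.1))
    (i := 0) (j := 0)

open Classical in
/-- The entry `x_ij ∈ E = V*` of `x ∈ M_I(E)`: `x_ij(v)` is the matrix entry
`⟪e_i, x(v) e_j⟫` of the operator `x(v)` on `ℓ²(I)`. -/
noncomputable def entry (x : CBMatrix V I) (i j : I) : StrongDual ℂ V :=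
  LinearMap.mkContinuousOfExistsBound
    { toFun := fun v => inner ℂ (lp.single 2 i (1 : ℂ) : Hil I)
        (x.toMap v (lp.single 2 j (1 : ℂ) : Hil I))
      map_add' := fun a b => by rw [map_add, add_apply, inner_add_right]
      map_smul' := fun c a => by
        rw [map_smul, smul_apply, inner_smul_right]; rfl }
    (by
      obtain ⟨C, hC⟩ := x.exists_bound
      refine ⟨C, fun v => ?_⟩
      have h1 : ‖(lp.single 2 i (1 : ℂ) : Hil I)‖ = 1 := by
        rw [lp.norm_single (by norm_num)]; simp
      have h2 : ‖(lp.single 2 j (1 : ℂ) : Hil I)‖ = 1 := by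
        rw [lp.norm_single (by norm_num)]; simp
      refine (norm_inner_le_norm (𝕜 := ℂ) (lp.single 2 i (1 : ℂ) : Hil I)
        (x.toMap v (lp.single 2 j (1 : ℂ) : Hil I))).trans ?_
      rw [h1, one_mul]
      refine ((x.toMap v).le_opNorm _).trans ?_
      rw [h2, mul_one]
      exact hC v)

end CBMatrix

/-! ## Noncommutative convex sets

Levels are indexed by index sets `I` instead of cardinals: compressions by the unitaries
`ℓ²(J) ≃ ℓ²(I)` for `#I = #J` identify the levels at all index sets of the same cardinality. -/

/-- `α` is an isometry. -/
def IsIsom {I J : Type*} (α : Hil J →L[ℂ] Hil I) : Prop :=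
  (ContinuousLinearMap.adjoint α) ∘L α = ContinuousLinearMap.id ℂ (Hil J)

/-- The graded subset `K = ∐ K_I` of `∐ M_I(E)`, over nonempty index sets `I` with at most `κ`
elements, is an nc convex set over `E = V*`. Levels at other index sets are irrelevant. -/
structure IsNCConvex {V : Type v} [NormedAddCommGroup V] [NormedSpace ℂ V] [OperatorSpace V]
    (κ : Cardinal.{u}) (K : ∀ I : Type u, Set (CBMatrix V I)) : Prop where
  /-- `∑ α_i x_i α_i^* ∈ K_I` for a bounded family `x_i ∈ K_{J i}` and isometries
  `α_i ∈ M_{I, J i}` with `∑ α_i α_i^* = 1`. -/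
  directSum : ∀ (I : Type u) [Nonempty I], #I ≤ κ →
    ∀ (ι : Type u) (J : ι → Type u) [∀ i, Nonempty (J i)], (∀ i, #(J i) ≤ κ) →
    ∀ x : (∀ i, CBMatrix V (J i)), (∀ i, x i ∈ K (J i)) → (∃ C : ℝ, ∀ i, (x i).NormLe C) →
    ∀ α : (∀ i, Hil (J i) →L[ℂ] Hil I), (∀ i, IsIsom (α i)) →
    WeakStarHasSum (fun i => α i ∘L ContinuousLinearMap.adjoint (α i))
      (ContinuousLinearMap.id ℂ (Hil I)) →
    ∀ z : CBMatrix V I,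
      (∀ v : V, WeakStarHasSum
        (fun i => α i ∘L (x i).toMap v ∘L ContinuousLinearMap.adjoint (α i)) (z.toMap v)) →
      z ∈ K I
  /-- `β^* x β ∈ K_J` for `x ∈ K_I` and an isometry `β ∈ M_{I, J}`. -/
  compression : ∀ (I J : Type u) [Nonempty I] [Nonempty J], #I ≤ κ → #J ≤ κ →
    ∀ x ∈ K I, ∀ β : Hil J →L[ℂ] Hil I, IsIsom β →
    ∀ z : CBMatrix V J,
      (∀ v : V, z.toMap v = ContinuousLinearMap.adjoint β ∘L x.toMap v ∘L β) → z ∈ K J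

/-- Each level is closed in the point-weak* topology. -/
def IsNCClosed {V : Type v} [NormedAddCommGroup V] [NormedSpace ℂ V] [OperatorSpace V]
    (κ : Cardinal.{u}) (K : ∀ I : Type u, Set (CBMatrix V I)) : Prop :=
  ∀ (I : Type u) [Nonempty I], #I ≤ κ → IsClosed (K I)

/-! ## Linear maps `φ : E → M_n` -/

/-- `φ : V* → M_n` is normal, i.e. continuous for the weak* topologies. -/
def IsNormalMap {V : Type v} [NormedAddCommGroup V] [NormedSpace ℂ V] {n : Type u}
    (φ : StrongDual ℂ V →ₗ[ℂ] MM n) : Prop :=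
  @Continuous (WeakDual ℂ V) (MM n) inferInstance (weakStarTopology (Hil n))
    (fun f => φ (WeakDual.toStrongDual f))

/-- The Hilbert space `H_p ⊗ H_n = ℓ²(p; H_n)`. -/
abbrev HilTensor (p n : Type*) : Type _ := lp (fun _ : p => Hil n) 2

open Classical in
/-- `T` is the operator `φ_p(x) = [φ(x_ij)] ∈ M_p(M_n) = B(H_p ⊗ H_n)`: its block matrix
entries are the operators `φ(x_ij) ∈ M_n`. Such a `T` is unique. -/
def IsAmplification {V : Type v} [NormedAddCommGroup V] [NormedSpace ℂ V] [OperatorSpace V]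
    {n p : Type u} (φ : StrongDual ℂ V →ₗ[ℂ] MM n) (x : CBMatrix V p)
    (T : HilTensor p n →L[ℂ] HilTensor p n) : Prop :=
  ∀ (i j : p) (ξ : Hil n), (T (lp.single 2 j ξ)) i = φ (x.entry i j) ξ

/-- `φ` is a normal completely bounded map such that `Re φ_p(x) ≤ 1` for all `p` and `x ∈ K_p`,
but not `Re φ_n(y) ≤ 1`; the operators `φ_p(x)` and `φ_n(y)` exist as bounded operators. -/
structure Separates {V : Type v} [NormedAddCommGroup V] [NormedSpace ℂ V] [OperatorSpace V]
    (κ : Cardinal.{u}) (K : ∀ I : Type u, Set (CBMatrix V I)) {n : Type u} (y : CBMatrix V n)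
    (φ : StrongDual ℂ V →ₗ[ℂ] MM n) : Prop where
  normal : IsNormalMap φ
  completelyBounded : CompletelyBounded (dualMatrixNorm V) (cstarMatrixNorm (MM n)) φ
  le_one : ∀ (p : Type u) [Nonempty p], #p ≤ κ → ∀ x ∈ K p,
    ∃ T, IsAmplification φ x T ∧ (realPart T : HilTensor p n →L[ℂ] HilTensor p n) ≤ 1
  not_le_one :
    ∃ T, IsAmplification φ y T ∧ ¬ (realPart T : HilTensor n n →L[ℂ] HilTensor n n) ≤ 1

/-! ## Operator systems -/

/-- The dual operator space `E = V*` is an operator system: it is completely isometrically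
identified with a unital self-adjoint subspace of a unital C*-algebra `A`. -/
structure OperatorSystemOn (A : Type w) [CStarAlgebra A] [PartialOrder A] [StarOrderedRing A]
    (V : Type v) [NormedAddCommGroup V] [NormedSpace ℂ V] [OperatorSpace V] where
  carrier : Submodule ℂ A
  one_mem : (1 : A) ∈ carrier
  star_mem : ∀ a ∈ carrier, star a ∈ carrier
  iso : carrier ≃ₗ[ℂ] StrongDual ℂ V
  completeIsometry : ∀ (m : ℕ) (s : Matrix (Fin m) (Fin m) carrier),
    dualMatrixNorm V m (s.map iso) = cstarMatrixNorm A m (s.map (fun a => (a : A)))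

namespace OperatorSystemOn

variable {A : Type w} [CStarAlgebra A] [PartialOrder A] [StarOrderedRing A]
  {V : Type v} [NormedAddCommGroup V] [NormedSpace ℂ V] [OperatorSpace V]

/-- The adjoint `e^*` of an element `e` of the operator system `E`. -/
noncomputable def adj (S : OperatorSystemOn A V) (e : StrongDual ℂ V) : StrongDual ℂ V :=
  S.iso ⟨star (S.iso.symm e : A), S.star_mem _ (S.iso.symm e).2⟩

/-- `x = x^*` in `M_I(E)`, where `(x^*)_ij = (x_ji)^*`. -/
def IsSelfAdjointMatrix (S : OperatorSystemOn A V) {I : Type u} (x : CBMatrix V I) : Prop :=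
  ∀ i j : I, x.entry i j = S.adj (x.entry j i)

/-- `φ = φ^*`, where `φ^*(e) = φ(e^*)^*`. -/
def IsSelfAdjointMap (S : OperatorSystemOn A V) {n : Type u}
    (φ : StrongDual ℂ V →ₗ[ℂ] MM n) : Prop :=
  ∀ e : StrongDual ℂ V, φ e = star (φ (S.adj e))

end OperatorSystemOn

/-! The proof is an Effros–Winkler argument carried out on a finite block.

Scalar separation. Since P_s y P_s → y over finite s ⊆ n and K_n is closed, some P_s y P_s is
outside K_n. The s × s matrices over E whose extension by zero lies in K_n form a weak* closed
convex set, so Hahn–Banach gives v_ij in the predual with Re ∑ x_ij(v_ij) ≤ 1 on K_n and Re ∑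
y_ij(v_ij) > 1; the bound can be normalised to 1 because 0 ∈ K_n (`exists_separating_functional`).

Domination. As 0 ∈ K, the set K is stable under compression by arbitrary contractions, so Re ∑ ⟪α
e_i, x(v_ij) α e_j⟫ ≤ ‖α‖² for every x ∈ K_p and every α. The constant ‖α‖² has to be improved to a
fixed functional of α^*α. The function A ↦ inf (‖A + α^*α‖ - Re ∑ ⟪α e_i, x(v_ij) α e_j⟫), over all
levels, x and α, is finite and sublinear: subadditivity comes from x ⊕ y and the column (α, β). A
linear functional below it is at most the norm and dominates on every α^*α
(`exists_dominating_functional`). On the matrix units of the block it becomes a positive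
semidefinite D with tr D ≤ 1 and Re ∑ ⟪a_i, x(v_ij) a_j⟫ ≤ Re ∑ D_ij ⟪a_i, a_j⟫ for all vectors a_i
(`exists_dominating_matrix`).

The map. Perturb D to a positive definite matrix with tr D < Re ∑ y_ij(v_ij), and write D = B^*B.
Set φ(e) = ∑ e(v_ij) |w_i⟩⟨w_j| with w_i the conjugated rows of B⁻¹. Then ⟪ζ, φ_p(x) ζ⟫ = ∑ ⟪a_i,
x(v_ij) a_j⟫ with a_i = (1 ⊗ ⟨w_i|) ζ, and the choice of w makes the dominating expression at most
‖ζ‖². With u_k the columns of B, biorthogonal to w, the vector ζ = ∑ e_k ⊗ u_k has a_i = e_i and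
‖ζ‖² = tr D, so φ_n(y) violates the inequality there.

Self-adjoint case. It suffices to replace v by its hermitian part before the domination step, which
needs the involution of E to come from one on the predual. Self-adjoint elements are recognised by
the norm bounds ‖a + it1‖² ≤ C² + t², which are weak* closed conditions; compactness of the unit
ball then makes e ↦ e^* weak* continuous on the ball, and completeness of the predual finishes
(`exists_predual_adj`). -/

/-! ### The C*-norm on M_m(B(H)) as the norm of a sesquilinear form -/

section MatrixForm

open InnerProductSpace WithCStarModule

variable {H : Type*} [NormedAddCommGroup H] [InnerProductSpace ℂ H] [CompleteSpace H]

theorem inner_toCLM_eq {m : ℕ} (T : Matrix (Fin m) (Fin m) (H →L[ℂ] H))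
    (v w : Fin m → (H →L[ℂ] H)) :
    (inner (H →L[ℂ] H) ((WithCStarModule.equiv (H →L[ℂ] H) _).symm w)
      (CStarMatrix.toCLM (CStarMatrix.ofMatrix T)
        ((WithCStarModule.equiv (H →L[ℂ] H) _).symm v)) : H →L[ℂ] H)
      = ∑ j, ∑ i, v i * T i j * star (w j) := by
  rw [WithCStarModule.pi_inner]
  refine Finset.sum_congr rfl fun j _ => ?_
  rw [WithCStarModule.inner_def, CStarMatrix.toCLM_apply_eq_sum]
  rw [WithCStarModule.equiv_symm_pi_apply, Finset.sum_mul]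
  rfl

theorem norm_equiv_symm_sq {m : ℕ} (v : Fin m → (H →L[ℂ] H)) :
    ‖(WithCStarModule.equiv (H →L[ℂ] H) _).symm v‖ ^ 2 = ‖∑ i, v i * star (v i)‖ := by
  rw [WithCStarModule.pi_norm_sq]
  rfl

/-- A vector ξ_i is encoded as the operator |h⟩⟨ξ_i| for a fixed unit vector h. Module inner
products then become scalar multiples of |h⟩⟨h|, and Cauchy–Schwarz in the C*-module applies. -/
theorem norm_sum_inner_le_cstarMatrixNorm {m : ℕ} (T : Matrix (Fin m) (Fin m) (H →L[ℂ] H))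
    (ξ η : Fin m → H) :
    ‖∑ i, ∑ j, inner ℂ (ξ i) (T i j (η j))‖
      ≤ cstarMatrixNorm (H →L[ℂ] H) m T * √(∑ i, ‖ξ i‖ ^ 2) * √(∑ j, ‖η j‖ ^ 2) := by
  rcases subsingleton_or_nontrivial H with hH | hH
  · have : ∀ x : H, x = 0 := fun x => Subsingleton.elim _ _
    simp [this (ξ _), this (η _)]
  obtain ⟨h, hh⟩ := exists_norm_eq H zero_le_one
  let v : (Fin m → H) → Fin m → (H →L[ℂ] H) := fun ζ i => rankOne ℂ h (ζ i)
  have hv : ∀ ζ, ‖(WithCStarModule.equiv (H →L[ℂ] H) _).symm (v ζ)‖ = √(∑ i, ‖ζ i‖ ^ 2) := fun ζ => by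
    rw [eq_comm, Real.sqrt_eq_iff_mul_self_eq (by positivity) (norm_nonneg _), ← sq,
      norm_equiv_symm_sq]
    have : ∑ i, v ζ i * star (v ζ i) = ((∑ i, ‖ζ i‖ ^ 2 : ℝ) : ℂ) • rankOne ℂ h h := by
      push_cast
      rw [Finset.sum_smul]
      refine Finset.sum_congr rfl fun i _ => ?_
      ext x
      simp [v, ContinuousLinearMap.star_eq_adjoint, smul_smul, mul_comm]
    rw [this, norm_smul, norm_rankOne, hh, Complex.norm_real, Real.norm_of_nonneg (by positivity)]
    simp
  have h1 := CStarModule.norm_inner_le (A := H →L[ℂ] H) _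
    (x := (WithCStarModule.equiv (H →L[ℂ] H) _).symm (v η))
    (y := CStarMatrix.toCLM (CStarMatrix.ofMatrix T)
      ((WithCStarModule.equiv (H →L[ℂ] H) _).symm (v ξ)))
  rw [inner_toCLM_eq] at h1
  have h2 : ∑ j, ∑ i, v ξ i * T i j * star (v η j)
      = (∑ i, ∑ j, inner ℂ (ξ i) (T i j (η j))) • rankOne ℂ h h := by
    rw [Finset.sum_comm, Finset.sum_smul]
    refine Finset.sum_congr rfl fun i _ => ?_
    rw [Finset.sum_smul]
    refine Finset.sum_congr rfl fun j _ => ?_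
    ext x
    simp [v, ContinuousLinearMap.star_eq_adjoint, smul_smul, mul_comm]
  rw [h2, norm_smul, norm_rankOne, hh, mul_one, mul_one] at h1
  refine h1.trans ?_
  have h3 := (CStarMatrix.toCLM (CStarMatrix.ofMatrix T)).le_opNorm
    ((WithCStarModule.equiv (H →L[ℂ] H) _).symm (v ξ))
  rw [hv] at h3 ⊢
  rw [mul_comm]
  exact mul_le_mul_of_nonneg_right h3 (by positivity)

/-- Converse of the previous estimate. If y is the value at x of the operator-valued inner product,
then ‖y‖² is the scalar form at the vectors v_i^* y and w_j^* x, whose square sums are controlled by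
the module norms; one factor ‖y‖ cancels. -/
theorem cstarMatrixNorm_le {m : ℕ} (T : Matrix (Fin m) (Fin m) (H →L[ℂ] H)) {C : ℝ} (hC : 0 ≤ C)
    (h : ∀ ξ η : Fin m → H, ‖∑ i, ∑ j, inner ℂ (ξ i) (T i j (η j))‖
      ≤ C * √(∑ i, ‖ξ i‖ ^ 2) * √(∑ j, ‖η j‖ ^ 2)) :
    cstarMatrixNorm (H →L[ℂ] H) m T ≤ C := by
  lift C to NNReal using hC
  refine CStarMatrix.norm_le_of_forall_inner_le fun v w => ?_
  obtain ⟨v, rfl⟩ := (WithCStarModule.equiv (H →L[ℂ] H) _).symm.surjective v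
  obtain ⟨w, rfl⟩ := (WithCStarModule.equiv (H →L[ℂ] H) _).symm.surjective w
  rw [inner_toCLM_eq]
  have key : ∀ (v : Fin m → (H →L[ℂ] H)) (x : H), √(∑ i, ‖star (v i) x‖ ^ 2)
      ≤ ‖(WithCStarModule.equiv (H →L[ℂ] H) _).symm v‖ * ‖x‖ := fun v x => by
    refine Real.sqrt_le_iff.2 ⟨by positivity, ?_⟩
    rw [mul_pow, norm_equiv_symm_sq]
    have e : ((∑ i, ‖star (v i) x‖ ^ 2 : ℝ) : ℂ) = inner ℂ x ((∑ i, v i * star (v i)) x) := by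
      rw [sum_apply, inner_sum]
      push_cast
      refine Finset.sum_congr rfl fun i _ => ?_
      change _ = inner ℂ x (v i (star (v i) x))
      rw [← ContinuousLinearMap.adjoint_inner_left,
        ← ContinuousLinearMap.star_eq_adjoint, inner_self_eq_norm_sq_to_K]
      rfl
    have e2 := congrArg norm e
    rw [Complex.norm_real, Real.norm_of_nonneg (by positivity)] at e2
    rw [e2]
    refine (norm_inner_le_norm _ _).trans ?_
    rw [sq ‖x‖, ← mul_assoc, mul_comm]
    exact mul_le_mul_of_nonneg_right (ContinuousLinearMap.le_opNorm _ _) (norm_nonneg _)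
  refine ContinuousLinearMap.opNorm_le_bound _ (by positivity) fun x => ?_
  set y := (∑ j, ∑ i, v i * T i j * star (w j)) x with hy
  have h4 : inner ℂ y y = ∑ i, ∑ j, inner ℂ (star (v i) y) (T i j (star (w j) x)) := by
    have aux : ∀ S : Fin m → Fin m → (H →L[ℂ] H),
        inner ℂ y ((∑ j, ∑ i, v i * S i j * star (w j)) x)
          = ∑ i, ∑ j, inner ℂ (star (v i) y) (S i j (star (w j) x)) := fun S => by
      rw [sum_apply, inner_sum, Finset.sum_comm]
      refine Finset.sum_congr rfl fun j _ => ?_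
      rw [sum_apply, inner_sum]
      refine Finset.sum_congr rfl fun i _ => ?_
      rw [ContinuousLinearMap.star_eq_adjoint (v i), ContinuousLinearMap.adjoint_inner_left]
      rfl
    exact aux T
  have h5 := h (fun i => star (v i) y) (fun j => star (w j) x)
  rw [← h4, inner_self_eq_norm_sq_to_K] at h5
  have h6 : ‖y‖ * ‖y‖ ≤ (C * ‖(WithCStarModule.equiv (H →L[ℂ] H) _).symm v‖
      * ‖(WithCStarModule.equiv (H →L[ℂ] H) _).symm w‖ * ‖x‖) * ‖y‖ := by
    refine le_trans (by simp [sq]) (h5.trans ((mul_le_mul (mul_le_mul_of_nonneg_left (key v y)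
      C.coe_nonneg) (key w x) (by positivity) (by positivity)).trans (le_of_eq (by ring))))
  rcases (norm_nonneg y).eq_or_lt with h0 | h0
  · rw [← h0]; positivity
  · exact le_of_mul_le_mul_right h6 h0

end MatrixForm

/-! ### Complete boundedness of rank one maps, sums and compressions -/

section OperatorSpaceNorms

open InnerProductSpace

section Scalar

open scoped Matrix.Norms.L2Operator

theorem l2_opNorm_column_le {m : ℕ} (b : Fin m → ℂ) :
    ‖(Matrix.of fun i (_ : Fin 1) => b i : Matrix (Fin m) (Fin 1) ℂ)‖ ≤ √(∑ i, ‖b i‖ ^ 2) := by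
  rw [Matrix.l2_opNorm_def]
  refine ContinuousLinearMap.opNorm_le_bound _ (by positivity) fun x => ?_
  rw [EuclideanSpace.norm_eq x]
  simp only [Finset.univ_unique, Finset.sum_singleton]
  rw [Real.sqrt_sq (norm_nonneg _)]
  rw [EuclideanSpace.norm_eq]
  have h : ∀ i, ‖(WithLp.toLp 2 ((Matrix.of fun i (_ : Fin 1) => b i :
      Matrix (Fin m) (Fin 1) ℂ).mulVec x.ofLp) : EuclideanSpace ℂ (Fin m)) i‖ ^ 2
      = ‖b i‖ ^ 2 * ‖x 0‖ ^ 2 := fun i => by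
    simp [Matrix.mulVec, dotProduct, mul_pow]
  have h' : √(∑ i, ‖b i‖ ^ 2 * ‖x 0‖ ^ 2) = √(∑ i, ‖b i‖ ^ 2) * ‖x 0‖ := by
    rw [← Finset.sum_mul, Real.sqrt_mul (by positivity), Real.sqrt_sq (norm_nonneg _)]
  refine le_trans (le_of_eq ?_) h'.le
  exact congrArg _ (Finset.sum_congr rfl fun i _ => h i)

theorem l2_opNorm_row_le {m : ℕ} (a : Fin m → ℂ) :
    ‖(Matrix.of fun (_ : Fin 1) i => a i : Matrix (Fin 1) (Fin m) ℂ)‖ ≤ √(∑ i, ‖a i‖ ^ 2) := by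
  rw [← Matrix.l2_opNorm_conjTranspose]
  refine le_trans (le_of_eq ?_) ((l2_opNorm_column_le fun i => star (a i)).trans
    (le_of_eq (by simp)))
  rfl

end Scalar

variable {V : Type v} [NormedAddCommGroup V] [NormedSpace ℂ V] [OperatorSpace V]
variable {H : Type*} [NormedAddCommGroup H] [InnerProductSpace ℂ H] [CompleteSpace H]
variable {H' : Type*} [NormedAddCommGroup H'] [InnerProductSpace ℂ H'] [CompleteSpace H']

theorem mnorm_nonneg (m : ℕ) (x : Matrix (Fin m) (Fin m) V) : 0 ≤ OperatorSpace.mnorm m x := by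
  have h := OperatorSpace.mnorm_add_le m x (-x)
  have h0 := OperatorSpace.mnorm_smul m (0 : ℂ) x
  have h1 := OperatorSpace.mnorm_smul m (-1 : ℂ) x
  rw [neg_one_smul] at h1
  rw [add_neg_cancel, ← zero_smul ℂ x, h0, h1] at h
  simp at h
  linarith

open scoped Matrix.Norms.L2Operator in
-- Bounded functionals are automatically completely bounded: the sum is f at the 1 × 1 matrix
-- obtained by multiplying x by the row a and the column b, which Ruan's axiom estimates.
theorem norm_sum_mul_apply_le (f : StrongDual ℂ V) {m : ℕ} (x : Matrix (Fin m) (Fin m) V)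
    (a b : Fin m → ℂ) :
    ‖∑ i, ∑ j, (a i * b j) * f (x i j)‖
      ≤ ‖f‖ * OperatorSpace.mnorm m x * √(∑ i, ‖a i‖ ^ 2) * √(∑ j, ‖b j‖ ^ 2) := by
  set α : Matrix (Fin 1) (Fin m) ℂ := Matrix.of fun _ i => a i
  set β : Matrix (Fin m) (Fin 1) ℂ := Matrix.of fun i _ => b i
  have h1 : ∑ i, ∑ j, (a i * b j) * f (x i j) = f (scalarConj α x β 0 0) := by
    simp [scalarConj, α, β]
  have h2 : scalarConj α x β = fun _ _ => scalarConj α x β 0 0 := by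
    ext i j
    rw [Subsingleton.elim i 0, Subsingleton.elim j 0]
  have h3 := OperatorSpace.mnorm_scalarConj_le 1 m α x β
  rw [h2, OperatorSpace.mnorm_one] at h3
  rw [h1]
  refine (f.le_opNorm _).trans ?_
  rw [mul_assoc, mul_assoc]
  refine mul_le_mul_of_nonneg_left (h3.trans ?_) (norm_nonneg _)
  have hb : 0 ≤ ‖β‖ := norm_nonneg β
  rw [← mul_assoc, mul_comm (OperatorSpace.mnorm m x)]
  exact mul_le_mul (mul_le_mul_of_nonneg_right (l2_opNorm_row_le a) (mnorm_nonneg _ _))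
    (l2_opNorm_column_le b) hb (mul_nonneg (by positivity) (mnorm_nonneg _ _))

omit [CompleteSpace H] in
theorem sqrt_sum_norm_inner_le {m : ℕ} (w : H) (ξ : Fin m → H) :
    √(∑ i, ‖inner ℂ w (ξ i)‖ ^ 2) ≤ ‖w‖ * √(∑ i, ‖ξ i‖ ^ 2) := by
  rw [← Real.sqrt_sq (norm_nonneg w), ← Real.sqrt_mul (by positivity)]
  refine Real.sqrt_le_sqrt ?_
  rw [Finset.mul_sum]
  refine Finset.sum_le_sum fun i _ => ?_
  rw [← mul_pow]
  exact pow_le_pow_left₀ (norm_nonneg _) (norm_inner_le_norm _ _) 2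

/-- The rank one map `v ↦ f(v) |w⟩⟨w'|`. -/
noncomputable def rankOneMap {E : Type*} [AddCommMonoid E] [Module ℂ E] (f : E →ₗ[ℂ] ℂ)
    (w w' : H) : E →ₗ[ℂ] (H →L[ℂ] H) :=
  f.smulRight (rankOne ℂ w w')

theorem norm_sum_inner_smul_rankOne_le {m : ℕ} (c : Matrix (Fin m) (Fin m) ℂ) {C : ℝ} (hC : 0 ≤ C)
    (h : ∀ a b : Fin m → ℂ, ‖∑ i, ∑ j, (a i * b j) * c i j‖
      ≤ C * √(∑ i, ‖a i‖ ^ 2) * √(∑ j, ‖b j‖ ^ 2)) (w w' : H) :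
    cstarMatrixNorm (H →L[ℂ] H) m (c.map fun z => z • rankOne ℂ w w') ≤ C * ‖w‖ * ‖w'‖ := by
  refine cstarMatrixNorm_le _ (by positivity) fun ξ η => ?_
  have h1 := h (fun i => inner ℂ (ξ i) w) (fun j => inner ℂ w' (η j))
  have h2 : ∑ i, ∑ j, inner ℂ (ξ i) ((c.map fun z => z • rankOne ℂ w w') i j (η j))
      = ∑ i, ∑ j, (inner ℂ (ξ i) w * inner ℂ w' (η j)) * c i j := by
    refine Finset.sum_congr rfl fun i _ => Finset.sum_congr rfl fun j _ => ?_
    simp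
    ring
  rw [h2]
  refine h1.trans ?_
  have h3 := sqrt_sum_norm_inner_le w ξ
  have h4 := sqrt_sum_norm_inner_le w' η
  simp_rw [norm_inner_symm w] at h3
  calc _ ≤ C * (‖w‖ * √(∑ i, ‖ξ i‖ ^ 2)) * (‖w'‖ * √(∑ i, ‖η i‖ ^ 2)) := by gcongr
    _ = _ := by ring

theorem cbBound_rankOneMap (f : StrongDual ℂ V) (w w' : H) :
    CBBound (OperatorSpace.mnorm (E := V)) (cstarMatrixNorm (H →L[ℂ] H)) (‖f‖ * ‖w‖ * ‖w'‖)
      (rankOneMap (f : V →ₗ[ℂ] ℂ) w w') := fun m x => by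
  have h := norm_sum_inner_smul_rankOne_le (x.map f)
    (mul_nonneg (norm_nonneg f) (mnorm_nonneg m x)) (norm_sum_mul_apply_le f x) w w'
  exact h.trans (le_of_eq (by ring))

section

variable {E : Type*} [AddCommMonoid E] [Module ℂ E] {N : MatrixNorm E}

theorem CBBound.mono (hN : ∀ m x, 0 ≤ N m x) {F : Type*} [AddCommMonoid F] [Module ℂ F]
    {N' : MatrixNorm F} {C C' : ℝ} (h : C ≤ C') {u : E →ₗ[ℂ] F} (hu : CBBound N N' C u) :
    CBBound N N' C' u := fun m x =>
  (hu m x).trans (mul_le_mul_of_nonneg_right h (hN m x))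

theorem CBBound.add {C C' : ℝ} {u u' : E →ₗ[ℂ] (H →L[ℂ] H)}
    (hu : CBBound N (cstarMatrixNorm _) C u) (hu' : CBBound N (cstarMatrixNorm _) C' u') :
    CBBound N (cstarMatrixNorm _) (C + C') (u + u') := fun m x => by
  rw [add_mul]
  refine le_trans ?_ (add_le_add (hu m x) (hu' m x))
  exact norm_add_le (CStarMatrix.ofMatrix (x.map u)) (CStarMatrix.ofMatrix (x.map u'))

theorem CompletelyBounded.add {u u' : E →ₗ[ℂ] (H →L[ℂ] H)}
    (hu : CompletelyBounded N (cstarMatrixNorm _) u)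
    (hu' : CompletelyBounded N (cstarMatrixNorm _) u') :
    CompletelyBounded N (cstarMatrixNorm _) (u + u') := by
  obtain ⟨C, hC⟩ := hu
  obtain ⟨C', hC'⟩ := hu'
  exact ⟨_, hC.add hC'⟩

theorem CompletelyBounded.zero :
    CompletelyBounded N (cstarMatrixNorm _) (0 : E →ₗ[ℂ] (H →L[ℂ] H)) := by
  refine ⟨0, fun m x => ?_⟩
  have h : x.map (0 : E →ₗ[ℂ] (H →L[ℂ] H)) = 0 := by ext i j; rfl
  rw [h]
  simp [cstarMatrixNorm]

theorem CompletelyBounded.sum {ι : Type*} (s : Finset ι) (u : ι → E →ₗ[ℂ] (H →L[ℂ] H))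
    (hu : ∀ i ∈ s, CompletelyBounded N (cstarMatrixNorm _) (u i)) :
    CompletelyBounded N (cstarMatrixNorm _) (∑ i ∈ s, u i) := by
  classical
  induction s using Finset.induction_on with
  | empty => exact CompletelyBounded.zero
  | insert a s ha ih =>
    rw [Finset.sum_insert ha]
    exact (hu a (by simp)).add (ih fun i hi => hu i (by simp [hi]))

/-- The map `v ↦ β^* x(v) β`. -/
noncomputable def conjMap (β : H' →L[ℂ] H) (x : E →ₗ[ℂ] (H →L[ℂ] H)) :
    E →ₗ[ℂ] (H' →L[ℂ] H') where
  toFun v := (ContinuousLinearMap.adjoint β) ∘L x v ∘L β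
  map_add' a b := by ext; simp
  map_smul' a b := by ext; simp

theorem CBBound.conjMap (hN : ∀ m x, 0 ≤ N m x) {C : ℝ} (hC : 0 ≤ C) {x : E →ₗ[ℂ] (H →L[ℂ] H)}
    (hx : CBBound N (cstarMatrixNorm _) C x) (β : H' →L[ℂ] H) :
    CBBound N (cstarMatrixNorm _) (C * ‖β‖ ^ 2) (conjMap β x) := fun m z => by
  have hz := hN m z
  refine cstarMatrixNorm_le _ (by positivity) fun ξ η => ?_
  have h1 := norm_sum_inner_le_cstarMatrixNorm (z.map x) (fun i => β (ξ i)) (fun i => β (η i))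
  have h2 : ∀ ξ : Fin m → H', √(∑ i, ‖β (ξ i)‖ ^ 2) ≤ ‖β‖ * √(∑ i, ‖ξ i‖ ^ 2) := fun ξ => by
    rw [← Real.sqrt_sq (norm_nonneg β), ← Real.sqrt_mul (by positivity)]
    refine Real.sqrt_le_sqrt ?_
    rw [Finset.mul_sum]
    refine Finset.sum_le_sum fun i _ => ?_
    rw [← mul_pow]
    exact pow_le_pow_left₀ (norm_nonneg _) (β.le_opNorm _) 2
  have h3 : ∑ i, ∑ j, inner ℂ (ξ i) ((z.map (_root_.conjMap β x)) i j (η j))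
      = ∑ i, ∑ j, inner ℂ (β (ξ i)) ((z.map x) i j (β (η j))) := by
    refine Finset.sum_congr rfl fun i _ => Finset.sum_congr rfl fun j _ => ?_
    simp [_root_.conjMap, ContinuousLinearMap.adjoint_inner_right]
  rw [h3]
  refine h1.trans ?_
  calc _ ≤ (C * N m z) * (‖β‖ * √(∑ i, ‖ξ i‖ ^ 2)) * (‖β‖ * √(∑ i, ‖η i‖ ^ 2)) := by
        gcongr
        · exact hx m z
        · exact h2 ξ
        · exact h2 η
    _ = _ := by ring

theorem CompletelyBounded.conjMap (hN : ∀ m x, 0 ≤ N m x) {x : E →ₗ[ℂ] (H →L[ℂ] H)}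
    (hx : CompletelyBounded N (cstarMatrixNorm _) x) (β : H' →L[ℂ] H) :
    CompletelyBounded N (cstarMatrixNorm _) (conjMap β x) := by
  obtain ⟨C, hC⟩ := hx
  exact ⟨_, (hC.mono hN (le_abs_self C)).conjMap hN (abs_nonneg C) β⟩

end

/-! ### The dual matrix norm -/

omit [OperatorSpace V] in
theorem evalMatrix_eq_sum {m : ℕ} (f : Matrix (Fin m) (Fin m) (StrongDual ℂ V)) :
    evalMatrix f = ∑ i, ∑ j, rankOneMap ((f i j : V →ₗ[ℂ] ℂ))
      (EuclideanSpace.single i (1 : ℂ)) (EuclideanSpace.single j (1 : ℂ)) := by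
  ext v ξ k
  simp [evalMatrix, rankOneMap, Matrix.mulVec, dotProduct, EuclideanSpace.inner_single_left,
    Pi.single_apply]

theorem completelyBounded_evalMatrix {m : ℕ} (f : Matrix (Fin m) (Fin m) (StrongDual ℂ V)) :
    CompletelyBounded (OperatorSpace.mnorm (E := V)) (cstarMatrixNorm _) (evalMatrix f) := by
  rw [evalMatrix_eq_sum]
  exact CompletelyBounded.sum _ _ fun i _ => CompletelyBounded.sum _ _ fun j _ =>
    ⟨_, cbBound_rankOneMap _ _ _⟩

theorem dualMatrixNorm_nonneg (m : ℕ) (f : Matrix (Fin m) (Fin m) (StrongDual ℂ V)) :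
    0 ≤ dualMatrixNorm V m f :=
  Real.sInf_nonneg fun _ h => h.1

theorem norm_evalMatrix_le {m : ℕ} (f : Matrix (Fin m) (Fin m) (StrongDual ℂ V)) (v : V) :
    ‖evalMatrix f v‖ ≤ dualMatrixNorm V m f * ‖v‖ := by
  have hne : {C : ℝ | 0 ≤ C ∧ CBBound (OperatorSpace.mnorm (E := V)) (cstarMatrixNorm _) C
      (evalMatrix f)}.Nonempty := by
    obtain ⟨C, hC⟩ := completelyBounded_evalMatrix f
    exact ⟨|C|, abs_nonneg C, hC.mono mnorm_nonneg (le_abs_self C)⟩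
  have h : ∀ C ∈ {C : ℝ | 0 ≤ C ∧ CBBound (OperatorSpace.mnorm (E := V)) (cstarMatrixNorm _) C
      (evalMatrix f)}, ‖evalMatrix f v‖ ≤ C * ‖v‖ := fun C hC => by
    have h := hC.2 1 (fun _ _ => v)
    rw [OperatorSpace.mnorm_one] at h
    refine le_trans ?_ h
    exact CStarMatrix.norm_entry_le_norm
      (M := CStarMatrix.ofMatrix
        (Matrix.map (m := Fin 1) (n := Fin 1) (fun _ _ => v) (evalMatrix f)))
      (i := 0) (j := 0)
  rcases (norm_nonneg v).eq_or_lt with h0 | h0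
  · obtain ⟨C, hC⟩ := hne
    have := h C hC
    rw [← h0] at this ⊢
    simpa using this
  · rw [← div_le_iff₀ h0]
    exact le_csInf hne fun C hC => by
      rw [div_le_iff₀ h0]
      exact h C hC

/-- Evaluation at a predual vector is completely bounded on V*, because M_m(V*) carries the norm of
CB(V, M_m). -/
theorem cbBound_dual_rankOneMap (v : V) (w w' : H) :
    CBBound (dualMatrixNorm V) (cstarMatrixNorm (H →L[ℂ] H)) (‖v‖ * ‖w‖ * ‖w'‖)
      (rankOneMap (NormedSpace.inclusionInDoubleDual ℂ V v : StrongDual ℂ V →ₗ[ℂ] ℂ) w w') :=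
    fun m f => by
  have h := norm_sum_inner_smul_rankOne_le (f.map fun e => e v)
    (mul_nonneg (dualMatrixNorm_nonneg m f) (norm_nonneg v)) (fun a b => ?_) w w'
  · exact h.trans (le_of_eq (by ring))
  · have h1 := norm_inner_le_norm (𝕜 := ℂ) (WithLp.toLp 2 fun i => star (a i))
      (evalMatrix f v (WithLp.toLp 2 b))
    have h2 : ∑ i, ∑ j, a i * b j * (f.map fun e => e v) i j = inner ℂ
        (WithLp.toLp 2 fun i => star (a i)) (evalMatrix f v (WithLp.toLp 2 b)) := by
      simp [evalMatrix, PiLp.inner_apply, Matrix.toEuclideanCLM_toLp, Matrix.mulVec, dotProduct,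
        Finset.sum_mul]
      refine Finset.sum_congr rfl fun i _ => Finset.sum_congr rfl fun j _ => by ring
    rw [h2]
    refine h1.trans ?_
    have h3 := (evalMatrix f v).le_opNorm (WithLp.toLp 2 b)
    have h4 := norm_evalMatrix_le f v
    have h5 : ‖(WithLp.toLp 2 fun i => star (a i) : EuclideanSpace ℂ (Fin m))‖
        = √(∑ i, ‖a i‖ ^ 2) := by
      rw [EuclideanSpace.norm_eq]; simp
    have h6 : ‖(WithLp.toLp 2 b : EuclideanSpace ℂ (Fin m))‖ = √(∑ i, ‖b i‖ ^ 2) := by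
      rw [EuclideanSpace.norm_eq]
    rw [h5, mul_comm]
    rw [h6] at h3
    calc _ ≤ (dualMatrixNorm V m f * ‖v‖ * √(∑ i, ‖b i‖ ^ 2)) * √(∑ i, ‖a i‖ ^ 2) := by
          gcongr
          exact h3.trans (by gcongr)
      _ = _ := by ring

theorem dualMatrixNorm_one (e : StrongDual ℂ V) :
    dualMatrixNorm V 1 (fun _ _ => e) = ‖e‖ := by
  apply le_antisymm
  · refine csInf_le ⟨0, fun _ h => h.1⟩ ⟨norm_nonneg e, ?_⟩
    have h : evalMatrix (m := 1) (Matrix.of fun _ _ => e) = rankOneMap (e : V →ₗ[ℂ] ℂ)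
        (EuclideanSpace.single 0 (1 : ℂ)) (EuclideanSpace.single 0 (1 : ℂ)) := by
      rw [evalMatrix_eq_sum]
      simp
    change CBBound _ _ _ (evalMatrix (m := 1) (Matrix.of fun _ _ => e))
    rw [h]
    simpa using cbBound_rankOneMap e (EuclideanSpace.single (0 : Fin 1) (1 : ℂ))
      (EuclideanSpace.single (0 : Fin 1) (1 : ℂ))
  · refine e.opNorm_le_bound (dualMatrixNorm_nonneg _ _) fun v => ?_
    refine le_trans ?_ (norm_evalMatrix_le (fun _ _ : Fin 1 => e) v)
    have := (evalMatrix (fun _ _ : Fin 1 => e) v).le_opNorm (EuclideanSpace.single 0 1)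
    simpa [evalMatrix, EuclideanSpace.norm_eq, Matrix.toEuclideanCLM_toLp, Matrix.mulVec,
      dotProduct] using this

end OperatorSpaceNorms

open InnerProductSpace

/-! ### Standard basis and coordinate projections of ℓ²(I) -/

section HilbertBasics

variable {I J : Type*}

open Classical in
/-- The standard basis vector `e_i` of `ℓ²(I)`. -/
noncomputable def stdVec (i : I) : Hil I := lp.single 2 i (1 : ℂ)

theorem inner_stdVec_left (i : I) (ξ : Hil I) : inner ℂ (stdVec i) ξ = ξ i := by
  classical
  rw [stdVec, lp.inner_single_left]
  simp

theorem stdVec_apply_self (i : I) : stdVec i i = 1 := by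
  classical
  rw [stdVec, lp.single_apply_self]

theorem stdVec_apply_ne {i j : I} (h : j ≠ i) : stdVec i j = 0 := by
  classical
  rw [stdVec, lp.single_apply_ne _ _ _ h]

theorem norm_stdVec (i : I) : ‖stdVec i‖ = 1 := by
  classical
  rw [stdVec, lp.norm_single (by norm_num)]
  simp

theorem hasSum_stdVec (ξ : Hil I) : HasSum (fun i => ξ i • stdVec i) ξ := by
  classical
  have h : (fun i => ξ i • stdVec i) = fun i => lp.single 2 i (ξ i) := by
    ext1 i
    rw [stdVec, ← lp.single_smul, smul_eq_mul, mul_one]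
  rw [h]
  exact lp.hasSum_single (by norm_num) ξ

/-- The projection onto the span of `e_i`, `i ∈ s`. -/
noncomputable def coordProj (s : Finset I) : Hil I →L[ℂ] Hil I :=
  ∑ i ∈ s, rankOne ℂ (stdVec i) (stdVec i)

theorem coordProj_apply (s : Finset I) (ξ : Hil I) :
    coordProj s ξ = ∑ i ∈ s, ξ i • stdVec i := by
  simp [coordProj, sum_apply, inner_stdVec_left]

theorem tendsto_coordProj (ξ : Hil I) :
    Filter.Tendsto (fun s => coordProj s ξ) Filter.atTop (nhds ξ) := by
  simp_rw [coordProj_apply]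
  exact hasSum_stdVec ξ

theorem adjoint_coordProj (s : Finset I) :
    ContinuousLinearMap.adjoint (coordProj s) = coordProj s := by
  simp [coordProj]

theorem sum_norm_sq_le (s : Finset I) (ξ : Hil I) : ∑ i ∈ s, ‖ξ i‖ ^ 2 ≤ ‖ξ‖ ^ 2 := by
  have := lp.sum_rpow_le_norm_rpow (p := 2) (by norm_num) ξ s
  simpa using this

theorem coordProj_comp_self (s : Finset I) : coordProj s ∘L coordProj s = coordProj s := by
  classical
  ext1 ξ
  rw [ContinuousLinearMap.comp_apply, coordProj_apply s (coordProj s ξ), coordProj_apply]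
  refine Finset.sum_congr rfl fun i hi => ?_
  congr 1
  rw [← inner_stdVec_left, inner_sum, Finset.sum_eq_single_of_mem i hi]
  · rw [inner_smul_right, inner_stdVec_left, stdVec_apply_self, mul_one]
  · intro j _ hj
    rw [inner_smul_right, inner_stdVec_left, stdVec_apply_ne hj.symm, mul_zero]

theorem norm_coordProj_le (s : Finset I) : ‖coordProj s‖ ≤ 1 := by
  refine ContinuousLinearMap.opNorm_le_bound _ zero_le_one fun ξ => ?_
  rw [one_mul]
  have h1 : inner ℂ (coordProj s ξ) (coordProj s ξ) = inner ℂ ξ (coordProj s ξ) := by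
    rw [← ContinuousLinearMap.adjoint_inner_right, adjoint_coordProj,
      ← ContinuousLinearMap.comp_apply, coordProj_comp_self]
  have h2 := norm_inner_le_norm (𝕜 := ℂ) ξ (coordProj s ξ)
  rw [← h1, inner_self_eq_norm_sq_to_K, norm_pow, sq] at h2
  simp only [Complex.coe_algebraMap, Complex.norm_real, norm_norm] at h2
  rcases (norm_nonneg (coordProj s ξ)).eq_or_lt with h0 | h0
  · rw [← h0]; exact norm_nonneg _
  · exact le_of_mul_le_mul_right h2 h0

end HilbertBasics

/-! ### The weak* topology of B(H) and finite truncations -/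

section WeakStar

variable {H : Type*} [NormedAddCommGroup H] [InnerProductSpace ℂ H]

omit [InnerProductSpace ℂ H] in
theorem summable_norm_mul_norm (ξ η : lp (fun _ : ℕ => H) 2) :
    Summable fun k => ‖ξ k‖ * ‖η k‖ := by
  have h : ∀ ζ : lp (fun _ : ℕ => H) 2, Summable fun k => ‖ζ k‖ ^ 2 := fun ζ => by
    have := (lp.memℓp ζ).summable (by norm_num)
    simpa using this
  refine Summable.of_nonneg_of_le (fun k => by positivity) (fun k => ?_) ((h ξ).add (h η))
  nlinarith [sq_nonneg (‖ξ k‖ - ‖η k‖), sq_nonneg (‖ξ k‖), sq_nonneg (‖η k‖)]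

theorem norm_inner_apply_le (T : H →L[ℂ] H) (x y : H) :
    ‖inner ℂ x (T y)‖ ≤ ‖T‖ * (‖x‖ * ‖y‖) := by
  refine (norm_inner_le_norm _ _).trans ?_
  have := mul_le_mul_of_nonneg_left (T.le_opNorm y) (norm_nonneg x)
  linarith

theorem summable_inner_apply (ξ η : lp (fun _ : ℕ => H) 2) (T : H →L[ℂ] H) :
    Summable fun k => (inner ℂ (ξ k) (T (η k)) : ℂ) :=
  Summable.of_norm_bounded ((summable_norm_mul_norm ξ η).mul_left ‖T‖)
    fun _ => norm_inner_apply_le T _ _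

/-- The weak*-continuous functional `T ↦ ∑ ⟪ξ_k, T η_k⟫`. -/
noncomputable def weakStarFunctional (ξ η : lp (fun _ : ℕ => H) 2) : (H →L[ℂ] H) →ₗ[ℂ] ℂ where
  toFun T := ∑' k, inner ℂ (ξ k) (T (η k))
  map_add' S T := by
    rw [← (summable_inner_apply ξ η S).tsum_add (summable_inner_apply ξ η T)]
    simp
  map_smul' c T := by
    simp [tsum_mul_left]

theorem tendsto_weakStar_iff {α : Type*} {l : Filter α} {f : α → (H →L[ℂ] H)} {a : H →L[ℂ] H} :
    Filter.Tendsto f l (@nhds _ (weakStarTopology H) a) ↔ ∀ ξ η,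
      Filter.Tendsto (fun x => weakStarFunctional ξ η (f x)) l
        (nhds (weakStarFunctional ξ η a)) := by
  simp only [nhds_iInf, nhds_induced, Filter.tendsto_iInf,
    Filter.tendsto_comap_iff]
  rfl

theorem continuous_weakStar_iff {α : Type*} [TopologicalSpace α] {f : α → (H →L[ℂ] H)} :
    @Continuous _ _ _ (weakStarTopology H) f ↔ ∀ ξ η,
      Continuous (fun x => weakStarFunctional ξ η (f x)) := by
  simp only [continuous_iInf_rng, continuous_induced_rng]
  rfl

theorem tendsto_coordProj_conj {I : Type*} (T : MM I) :
    Filter.Tendsto (fun s => coordProj s ∘L T ∘L coordProj s) Filter.atTop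
      (@nhds _ (weakStarTopology (Hil I)) T) := by
  rw [tendsto_weakStar_iff]
  intro ξ η
  -- Truncations converge in each matrix coefficient and stay bounded by ‖T‖, so dominated
  -- convergence handles the whole series defining a weak* functional.
  refine tendsto_tsum_of_dominated_convergence (bound := fun k => ‖T‖ * (‖ξ k‖ * ‖η k‖))
    ((summable_norm_mul_norm ξ η).mul_left ‖T‖) (fun k => ?_) (Filter.Eventually.of_forall ?_)
  · have h1 := tendsto_coordProj (ξ k)
    have h2 := (T.continuous.tendsto _).comp (tendsto_coordProj (η k))
    refine (h1.inner h2).congr fun s => ?_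
    have h3 := ContinuousLinearMap.adjoint_inner_left (coordProj s) (T (coordProj s (η k))) (ξ k)
    rw [adjoint_coordProj] at h3
    exact h3
  · intro s k
    refine (norm_inner_apply_le _ _ _).trans ?_
    have h1 : ‖coordProj s ∘L T ∘L coordProj s‖ ≤ ‖T‖ := by
      refine (ContinuousLinearMap.opNorm_comp_le _ _).trans ?_
      have h2 := ContinuousLinearMap.opNorm_comp_le T (coordProj s)
      have h3 := norm_coordProj_le s
      have h4 := norm_nonneg T
      have h5 := norm_nonneg (coordProj s)
      have h6 := norm_nonneg (T ∘L coordProj s)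
      nlinarith
    exact mul_le_mul_of_nonneg_right h1 (by positivity)

theorem tendsto_coordProj_weakStar {I : Type*} :
    Filter.Tendsto (fun s : Finset I => coordProj s) Filter.atTop
      (@nhds _ (weakStarTopology (Hil I)) (ContinuousLinearMap.id ℂ (Hil I))) := by
  refine (tendsto_coordProj_conj (ContinuousLinearMap.id ℂ (Hil I))).congr fun s => ?_
  rw [ContinuousLinearMap.id_comp, coordProj_comp_self]

theorem weakStarHasSum_fintype {ι : Type*} [Fintype ι] {f : ι → (H →L[ℂ] H)} {a : H →L[ℂ] H}
    (h : ∑ i, f i = a) : WeakStarHasSum f a := by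
  rw [WeakStarHasSum, Filter.OrderTop.atTop_eq, ← h]
  exact @tendsto_pure_nhds (H →L[ℂ] H) (weakStarTopology H) _ _ _

end WeakStar

/-! ### The isometries of ℓ²(I) and ℓ²(J) into ℓ²(I ⊕ J) -/

section DirectSumIsometries

variable {I J : Type*}

/-- Restriction of square summable families along an injective map. -/
noncomputable def restrictCLM (g : I → J) (hg : Function.Injective g) : Hil J →L[ℂ] Hil I :=
  LinearMap.mkContinuous
    { toFun := fun ξ => ⟨fun i => ξ (g i), memℓp_gen <| by
        have := (lp.memℓp ξ).summable (by norm_num)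
        exact this.comp_injective hg⟩
      map_add' := fun _ _ => rfl
      map_smul' := fun _ _ => rfl } 1 fun ξ => by
    rw [one_mul]
    refine lp.norm_le_of_forall_sum_le (by norm_num) (norm_nonneg _) fun s => ?_
    classical
    have := lp.sum_rpow_le_norm_rpow (p := 2) (by norm_num) ξ (s.image g)
    rw [Finset.sum_image (fun _ _ _ _ h => hg h)] at this
    exact this

/-- The isometry `ℓ²(I) → ℓ²(I ⊕ J)`. -/
noncomputable def inlCLM (I J : Type*) : Hil I →L[ℂ] Hil (I ⊕ J) :=
  ContinuousLinearMap.adjoint (restrictCLM Sum.inl Sum.inl_injective)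

/-- The isometry `ℓ²(J) → ℓ²(I ⊕ J)`. -/
noncomputable def inrCLM (I J : Type*) : Hil J →L[ℂ] Hil (I ⊕ J) :=
  ContinuousLinearMap.adjoint (restrictCLM Sum.inr Sum.inr_injective)

theorem adjoint_inlCLM :
    ContinuousLinearMap.adjoint (inlCLM I J) = restrictCLM Sum.inl Sum.inl_injective :=
  ContinuousLinearMap.adjoint_adjoint _

theorem adjoint_inrCLM :
    ContinuousLinearMap.adjoint (inrCLM I J) = restrictCLM Sum.inr Sum.inr_injective :=
  ContinuousLinearMap.adjoint_adjoint _

theorem inl_comp_adjoint_add_inr_comp_adjoint :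
    inlCLM I J ∘L ContinuousLinearMap.adjoint (inlCLM I J)
      + inrCLM I J ∘L ContinuousLinearMap.adjoint (inrCLM I J) = ContinuousLinearMap.id ℂ _ := by
  ext1 η
  refine ext_inner_left ℂ fun ξ => ?_
  rw [add_apply, inner_add_right, ContinuousLinearMap.comp_apply, ContinuousLinearMap.comp_apply,
    ← ContinuousLinearMap.adjoint_inner_left (inlCLM I J),
    ← ContinuousLinearMap.adjoint_inner_left (inrCLM I J), adjoint_inlCLM, adjoint_inrCLM]
  refine HasSum.unique ?_ (lp.hasSum_inner ξ η)
  exact HasSum.sum (lp.hasSum_inner (restrictCLM Sum.inl Sum.inl_injective ξ)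
    (restrictCLM Sum.inl Sum.inl_injective η)) (lp.hasSum_inner
    (restrictCLM Sum.inr Sum.inr_injective ξ) (restrictCLM Sum.inr Sum.inr_injective η))

end DirectSumIsometries

section DirectSumIsometries

variable {I J : Type*}

/-- Evaluating the resolution of the identity at a ζ with prescribed restrictions gives all four
relations between the two isometries. -/
theorem exists_restrictCLM_eq (ξ : Hil I) (η : Hil J) :
    ∃ ζ : Hil (I ⊕ J), restrictCLM Sum.inl Sum.inl_injective ζ = ξ ∧
      restrictCLM Sum.inr Sum.inr_injective ζ = η := by
  refine ⟨⟨fun i => Sum.elim (fun i => ξ i) (fun j => η j) i, memℓp_gen ?_⟩, ?_, ?_⟩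
  · have h1 := (lp.memℓp ξ).summable (by norm_num)
    have h2 := (lp.memℓp η).summable (by norm_num)
    exact (HasSum.sum (f := fun i : I ⊕ J =>
      ‖(Sum.elim (fun i => ξ i) (fun j => η j) i : ℂ)‖ ^ (2 : ENNReal).toReal)
      h1.hasSum h2.hasSum).summable
  · ext i; rfl
  · ext i; rfl

theorem adjoint_inl_comp_inl : ContinuousLinearMap.adjoint (inlCLM I J) ∘L inlCLM I J
    = ContinuousLinearMap.id ℂ _ := by
  ext1 ξ
  obtain ⟨ζ, h1, h2⟩ := exists_restrictCLM_eq ξ (0 : Hil J)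
  have h := congrArg (· ζ) (inl_comp_adjoint_add_inr_comp_adjoint (I := I) (J := J))
  simp only [add_apply, ContinuousLinearMap.comp_apply, adjoint_inlCLM, adjoint_inrCLM, h1, h2,
    map_zero, add_zero, ContinuousLinearMap.id_apply] at h ⊢
  rw [h, h1]

theorem adjoint_inr_comp_inl : ContinuousLinearMap.adjoint (inrCLM I J) ∘L inlCLM I J = 0 := by
  ext1 ξ
  obtain ⟨ζ, h1, h2⟩ := exists_restrictCLM_eq ξ (0 : Hil J)
  have h := congrArg (· ζ) (inl_comp_adjoint_add_inr_comp_adjoint (I := I) (J := J))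
  simp only [add_apply, ContinuousLinearMap.comp_apply, adjoint_inlCLM, adjoint_inrCLM, h1, h2,
    map_zero, add_zero, ContinuousLinearMap.id_apply] at h ⊢
  rw [h, h2, zero_apply]

theorem adjoint_inr_comp_inr : ContinuousLinearMap.adjoint (inrCLM I J) ∘L inrCLM I J
    = ContinuousLinearMap.id ℂ _ := by
  ext1 ξ
  obtain ⟨ζ, h1, h2⟩ := exists_restrictCLM_eq (0 : Hil I) ξ
  have h := congrArg (· ζ) (inl_comp_adjoint_add_inr_comp_adjoint (I := I) (J := J))
  simp only [add_apply, ContinuousLinearMap.comp_apply, adjoint_inlCLM, adjoint_inrCLM, h1, h2,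
    map_zero, zero_add, ContinuousLinearMap.id_apply] at h ⊢
  rw [h, h2]

theorem adjoint_inl_comp_inr : ContinuousLinearMap.adjoint (inlCLM I J) ∘L inrCLM I J = 0 := by
  ext1 ξ
  obtain ⟨ζ, h1, h2⟩ := exists_restrictCLM_eq (0 : Hil I) ξ
  have h := congrArg (· ζ) (inl_comp_adjoint_add_inr_comp_adjoint (I := I) (J := J))
  simp only [add_apply, ContinuousLinearMap.comp_apply, adjoint_inlCLM, adjoint_inrCLM, h1, h2,
    map_zero, zero_add, ContinuousLinearMap.id_apply] at h ⊢
  rw [h, h1, zero_apply]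

end DirectSumIsometries

theorem exists_adjoint_comp_self_eq {H : Type*} [NormedAddCommGroup H] [InnerProductSpace ℂ H]
    [CompleteSpace H] {T : H →L[ℂ] H} (hT : 0 ≤ T) :
    ∃ γ : H →L[ℂ] H, ContinuousLinearMap.adjoint γ ∘L γ = T := by
  refine ⟨CFC.sqrt T, ?_⟩
  have h1 := CFC.sqrt_mul_sqrt_self T hT
  have h2 : IsSelfAdjoint (CFC.sqrt T) := .of_nonneg (CFC.sqrt_nonneg _)
  rw [← ContinuousLinearMap.star_eq_adjoint, h2.star_eq]
  exact h1

/-! ### Topology, compressions and direct sums in M_I(E) -/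

namespace CBMatrix

variable {V : Type v} [NormedAddCommGroup V] [NormedSpace ℂ V] [OperatorSpace V] {I J : Type u}

theorem tendsto_iff {α : Type*} {l : Filter α} {f : α → CBMatrix V I} {a : CBMatrix V I} :
    Filter.Tendsto f l (nhds a) ↔ ∀ v, Filter.Tendsto (fun x => (f x).toMap v) l
      (@nhds _ (weakStarTopology (Hil I)) (a.toMap v)) := by
  change Filter.Tendsto f l (@nhds _ (⨅ v : V, TopologicalSpace.induced
    (fun x : CBMatrix V I => x.toMap v) (weakStarTopology (Hil I))) a) ↔ _
  rw [nhds_iInf, Filter.tendsto_iInf]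
  refine forall_congr' fun v => ?_
  rw [@nhds_induced _ _ (weakStarTopology (Hil I)), Filter.tendsto_comap_iff]
  rfl

theorem continuous_iff {α : Type*} [TopologicalSpace α] {f : α → CBMatrix V I} :
    Continuous f ↔ ∀ v, @Continuous _ _ _ (weakStarTopology (Hil I)) fun x => (f x).toMap v := by
  change @Continuous _ _ _ (⨅ v : V, TopologicalSpace.induced
    (fun x : CBMatrix V I => x.toMap v) (weakStarTopology (Hil I))) f ↔ _
  refine continuous_iInf_rng.trans (forall_congr' fun v => ?_)
  let _ := weakStarTopology (Hil I)
  exact continuous_induced_rng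

/-- The compression `β^* x β`. -/
noncomputable def compress (x : CBMatrix V I) (β : Hil J →L[ℂ] Hil I) : CBMatrix V J :=
  ⟨conjMap β x.toMap, CompletelyBounded.conjMap mnorm_nonneg x.2 β⟩

theorem compress_toMap (x : CBMatrix V I) (β : Hil J →L[ℂ] Hil I) (v : V) :
    (x.compress β).toMap v = ContinuousLinearMap.adjoint β ∘L x.toMap v ∘L β := rfl

theorem inner_compress (x : CBMatrix V I) (β : Hil J →L[ℂ] Hil I) (v : V) (ξ η : Hil J) :
    inner ℂ ξ ((x.compress β).toMap v η) = inner ℂ (β ξ) (x.toMap v (β η)) := by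
  rw [compress_toMap, ContinuousLinearMap.comp_apply, ContinuousLinearMap.adjoint_inner_right]
  rfl

noncomputable instance : Add (CBMatrix V I) := ⟨fun x y => ⟨x.toMap + y.toMap, x.2.add y.2⟩⟩

theorem add_toMap (x y : CBMatrix V I) (v : V) : (x + y).toMap v = x.toMap v + y.toMap v := rfl

theorem zero_toMap (v : V) : (0 : CBMatrix V I).toMap v = 0 := rfl

theorem toMap_ext {x y : CBMatrix V I} (h : ∀ v, x.toMap v = y.toMap v) : x = y :=
  Subtype.ext (LinearMap.ext h)

theorem entry_apply (x : CBMatrix V I) (i j : I) (v : V) :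
    x.entry i j v = inner ℂ (stdVec i) (x.toMap v (stdVec j)) := rfl

/-- The direct sum `x ⊕ y`. -/
noncomputable def directSum (x : CBMatrix V I) (y : CBMatrix V J) : CBMatrix V (I ⊕ J) :=
  x.compress (ContinuousLinearMap.adjoint (inlCLM I J))
    + y.compress (ContinuousLinearMap.adjoint (inrCLM I J))

end CBMatrix

/-! ### Closure properties of nc convex sets -/

namespace IsNCConvex

variable {V : Type v} [NormedAddCommGroup V] [NormedSpace ℂ V] [OperatorSpace V]
  {κ : Cardinal.{u}} {K : ∀ I : Type u, Set (CBMatrix V I)}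

theorem directSum_mem (hK : IsNCConvex κ K) (hκ : ℵ₀ ≤ κ) {I J : Type u} [Nonempty I] [Nonempty J]
    (hI : #I ≤ κ) (hJ : #J ≤ κ) {x : CBMatrix V I} {y : CBMatrix V J} (hx : x ∈ K I)
    (hy : y ∈ K J) : x.directSum y ∈ K (I ⊕ J) := by
  obtain ⟨C, hC⟩ := x.2
  obtain ⟨C', hC'⟩ := y.2
  -- The family of two summands is indexed by a lifted `Bool`, since index sets must live in
  -- universe `u`.
  have hsum : ∀ f : ULift.{u} Bool → MM (I ⊕ J), ∑ b, f b = f ⟨true⟩ + f ⟨false⟩ := fun f => by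
    rw [← Equiv.ulift.symm.sum_comp]
    simp
  let L : ULift.{u} Bool → Type u := fun b => bif b.down then I else J
  have : ∀ b, Nonempty (L b) := by rintro ⟨_ | _⟩ <;> assumption
  let z : ∀ b, CBMatrix V (L b)
    | ⟨true⟩ => x
    | ⟨false⟩ => y
  let α : ∀ b, Hil (L b) →L[ℂ] Hil (I ⊕ J)
    | ⟨true⟩ => inlCLM I J
    | ⟨false⟩ => inrCLM I J
  refine hK.directSum (I ⊕ J) ?_ (ULift.{u} Bool) L ?_ z ?_ ⟨max C C', ?_⟩ α ?_ ?_ _ fun v => ?_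
  · rw [← Cardinal.add_def]
    exact Cardinal.add_le_of_le hκ hI hJ
  · rintro ⟨_ | _⟩ <;> assumption
  · rintro ⟨_ | _⟩ <;> assumption
  · rintro ⟨_ | _⟩
    · exact hC'.mono mnorm_nonneg (le_max_right _ _)
    · exact hC.mono mnorm_nonneg (le_max_left _ _)
  · rintro ⟨_ | _⟩
    · exact adjoint_inr_comp_inr
    · exact adjoint_inl_comp_inl
  · exact weakStarHasSum_fintype ((hsum _).trans inl_comp_adjoint_add_inr_comp_adjoint)
  · refine weakStarHasSum_fintype ((hsum _).trans ?_)
    rw [CBMatrix.directSum, CBMatrix.add_toMap, CBMatrix.compress_toMap, CBMatrix.compress_toMap,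
      ContinuousLinearMap.adjoint_adjoint, ContinuousLinearMap.adjoint_adjoint]

/-- The column (β, γ) is an isometry into ℓ²(I ⊕ J), and it compresses x ⊕ y to β^* x β + γ^* y γ.
-/
theorem conj_add_conj_mem (hK : IsNCConvex κ K) (hκ : ℵ₀ ≤ κ) {I J L : Type u} [Nonempty I]
    [Nonempty J] [Nonempty L] (hI : #I ≤ κ) (hJ : #J ≤ κ) (hL : #L ≤ κ) {x : CBMatrix V I}
    {y : CBMatrix V J} (hx : x ∈ K I) (hy : y ∈ K J) (β : Hil L →L[ℂ] Hil I)
    (γ : Hil L →L[ℂ] Hil J)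
    (h : ContinuousLinearMap.adjoint β ∘L β + ContinuousLinearMap.adjoint γ ∘L γ
      = ContinuousLinearMap.id ℂ _) : x.compress β + y.compress γ ∈ K L := by
  have h1 : ∀ ξ : Hil I, ContinuousLinearMap.adjoint (inlCLM I J) (inlCLM I J ξ) = ξ :=
    fun ξ => congrArg (· ξ) adjoint_inl_comp_inl
  have h2 : ∀ ξ : Hil I, ContinuousLinearMap.adjoint (inrCLM I J) (inlCLM I J ξ) = 0 :=
    fun ξ => congrArg (fun T : Hil I →L[ℂ] Hil J => T ξ) adjoint_inr_comp_inl
  have h3 : ∀ ξ : Hil J, ContinuousLinearMap.adjoint (inlCLM I J) (inrCLM I J ξ) = 0 :=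
    fun ξ => congrArg (fun T : Hil J →L[ℂ] Hil I => T ξ) adjoint_inl_comp_inr
  have h4 : ∀ ξ : Hil J, ContinuousLinearMap.adjoint (inrCLM I J) (inrCLM I J ξ) = ξ :=
    fun ξ => congrArg (· ξ) adjoint_inr_comp_inr
  refine hK.compression (I ⊕ J) L ?_ hL _ (hK.directSum_mem hκ hI hJ hx hy)
    (inlCLM I J ∘L β + inrCLM I J ∘L γ) ?_ _ fun v => ?_
  · rw [← Cardinal.add_def]
    exact Cardinal.add_le_of_le hκ hI hJ
  · rw [IsIsom, ← h]
    ext1 ξ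
    simp [ContinuousLinearMap.adjoint_comp, h1, h2, h3, h4]
  · ext1 ξ
    simp [CBMatrix.directSum, CBMatrix.add_toMap, CBMatrix.compress_toMap,
      ContinuousLinearMap.adjoint_comp, h1, h2, h3, h4]

/-- The zero of level I is the direct sum of copies of 0_E along the standard basis vectors. -/
theorem zero_mem (hK : IsNCConvex κ K) (hκ : ℵ₀ ≤ κ) (h0 : (0 : CBMatrix V PUnit.{u + 1}) ∈ K PUnit)
    (I : Type u) [Nonempty I] (hI : #I ≤ κ) : (0 : CBMatrix V I) ∈ K I := by
  let α : I → Hil PUnit.{u + 1} →L[ℂ] Hil I := fun i => rankOne ℂ (stdVec i) (stdVec PUnit.unit)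
  refine hK.directSum I hI I (fun _ => PUnit) (fun _ => ?_) (fun _ => 0) (fun _ => h0)
    ⟨0, fun _ m x => ?_⟩ α (fun i => ?_) ?_ 0 fun v => ?_
  · rw [Cardinal.mk_punit]
    exact Cardinal.one_le_aleph0.trans hκ
  · have h : x.map (0 : CBMatrix V PUnit.{u + 1}).toMap = 0 := by ext i j; rfl
    rw [h]
    simp [cstarMatrixNorm]
  · rw [IsIsom]
    ext ξ k
    simp [α, inner_stdVec_left, norm_stdVec, stdVec_apply_self]
  · rw [WeakStarHasSum]
    refine tendsto_coordProj_weakStar.congr fun s => Finset.sum_congr rfl fun i _ => ?_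
    ext1 ξ
    simp [α, norm_stdVec]
  · rw [WeakStarHasSum, tendsto_weakStar_iff]
    intro ξ η
    simp only [CBMatrix.zero_toMap, ContinuousLinearMap.zero_comp, ContinuousLinearMap.comp_zero,
      Finset.sum_const_zero]
    exact tendsto_const_nhds

/-- A contraction β is completed to an isometric column by γ = (1 - β^*β)^{1/2}; the second summand
is γ^* 0 γ = 0. -/
theorem compress_mem (hK : IsNCConvex κ K) (hκ : ℵ₀ ≤ κ)
    (h0 : (0 : CBMatrix V PUnit.{u + 1}) ∈ K PUnit) {I J : Type u} [Nonempty I] [Nonempty J]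
    (hI : #I ≤ κ) (hJ : #J ≤ κ) {x : CBMatrix V I} (hx : x ∈ K I) (β : Hil J →L[ℂ] Hil I)
    (hβ : ‖β‖ ≤ 1) : x.compress β ∈ K J := by
  have hnn : (0 : MM J) ≤ 1 - ContinuousLinearMap.adjoint β ∘L β := by
    rw [ContinuousLinearMap.nonneg_iff_isPositive, ContinuousLinearMap.isPositive_def']
    refine ⟨(IsSelfAdjoint.one _).sub
      (ContinuousLinearMap.isPositive_adjoint_comp_self β).isSelfAdjoint, ?_⟩
    intro ξ
    have h1 : ‖β ξ‖ ≤ ‖ξ‖ := (β.le_opNorm ξ).trans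
      (mul_le_of_le_one_left (norm_nonneg _) hβ)
    have h2 : ‖β ξ‖ ^ 2 ≤ ‖ξ‖ ^ 2 := pow_le_pow_left₀ (norm_nonneg _) h1 2
    simp only [ContinuousLinearMap.reApplyInnerSelf_apply, sub_apply, inner_sub_left,
      ContinuousLinearMap.comp_apply, ContinuousLinearMap.adjoint_inner_left, one_apply_eq_self,
      map_sub, inner_self_eq_norm_sq]
    linarith
  obtain ⟨γ, hγ⟩ : ∃ γ : MM J, ContinuousLinearMap.adjoint β ∘L β
      + ContinuousLinearMap.adjoint γ ∘L γ = ContinuousLinearMap.id ℂ _ := by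
    obtain ⟨γ, hγ⟩ := exists_adjoint_comp_self_eq hnn
    refine ⟨γ, ?_⟩
    rw [hγ]
    change _ + _ = 1
    abel
  have h := hK.conj_add_conj_mem hκ hI hJ hJ hx (hK.zero_mem hκ h0 J hJ) β γ hγ
  convert h using 1
  refine CBMatrix.toMap_ext fun v => ?_
  simp [CBMatrix.add_toMap, CBMatrix.compress_toMap, CBMatrix.zero_toMap]

theorem convex_comb_mem (hK : IsNCConvex κ K) (hκ : ℵ₀ ≤ κ) {I : Type u} [Nonempty I]
    (hI : #I ≤ κ) {x y z : CBMatrix V I} (hx : x ∈ K I) (hy : y ∈ K I) {a b : ℝ} (ha : 0 ≤ a)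
    (hb : 0 ≤ b) (hab : a + b = 1)
    (hz : ∀ v, z.toMap v = (a : ℂ) • x.toMap v + (b : ℂ) • y.toMap v) : z ∈ K I := by
  have key : ∀ {a : ℝ}, 0 ≤ a → ∀ T : MM I, ContinuousLinearMap.adjoint
      (((√a : ℝ) : ℂ) • ContinuousLinearMap.id ℂ (Hil I)) ∘L T ∘L
      (((√a : ℝ) : ℂ) • ContinuousLinearMap.id ℂ (Hil I)) = (a : ℂ) • T := fun {a} ha T => by
    rw [map_smulₛₗ, ContinuousLinearMap.adjoint_id, Complex.conj_ofReal]
    simp only [ContinuousLinearMap.comp_smul, ContinuousLinearMap.smul_comp,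
      ContinuousLinearMap.id_comp, ContinuousLinearMap.comp_id, smul_smul]
    rw [← Complex.ofReal_mul, Real.mul_self_sqrt ha]
  have h := hK.conj_add_conj_mem hκ hI hI hI hx hy
    (((√a : ℝ) : ℂ) • ContinuousLinearMap.id ℂ (Hil I))
    (((√b : ℝ) : ℂ) • ContinuousLinearMap.id ℂ (Hil I)) (by
      have h1 := key ha (ContinuousLinearMap.id ℂ _)
      have h2 := key hb (ContinuousLinearMap.id ℂ _)
      rw [ContinuousLinearMap.id_comp] at h1 h2
      rw [h1, h2, ← add_smul, ← Complex.ofReal_add, hab, Complex.ofReal_one, one_smul])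
  convert h using 1
  refine CBMatrix.toMap_ext fun v => ?_
  rw [hz, CBMatrix.add_toMap, CBMatrix.compress_toMap, CBMatrix.compress_toMap, key ha, key hb]

end IsNCConvex

/-! ### Weak* functionals and scalar separation on a finite block -/

section

variable {V : Type v} [NormedAddCommGroup V] [NormedSpace ℂ V]

theorem exists_eq_eval_of_weakDual (g : StrongDual ℂ (WeakDual ℂ V)) :
    ∃ v : V, ∀ f : WeakDual ℂ V, g f = f v := by
  obtain ⟨v, hv⟩ := LinearMap.dualEmbedding_surjective (B := topDualPairing ℂ V) g
  exact ⟨v, fun f => by rw [← hv]; rfl⟩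

theorem exists_eq_sum_eval {ι : Type*} [Fintype ι]
    (g : StrongDual ℂ (ι → ι → WeakDual ℂ V)) :
    ∃ v : ι → ι → V, ∀ f : ι → ι → WeakDual ℂ V, g f = ∑ i, ∑ j, f i j (v i j) := by
  classical
  have h := fun i j => exists_eq_eval_of_weakDual
    ((g.comp (ContinuousLinearMap.single ℂ (fun _ : ι => ι → WeakDual ℂ V) i)).comp
      (ContinuousLinearMap.single ℂ (fun _ : ι => WeakDual ℂ V) j))
  choose v hv using h
  refine ⟨v, fun f => ?_⟩
  conv_lhs => rw [← Finset.univ_sum_single f, map_sum]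
  refine Finset.sum_congr rfl fun i _ => ?_
  conv_lhs => rw [← Finset.univ_sum_single (f i)]
  have h1 : ∀ j, g (Pi.single i (Pi.single j (f i j))) = f i j (v i j) := fun j => hv i j (f i j)
  rw [← Finset.sum_congr rfl fun j _ => h1 j]
  exact map_sum (g.comp (ContinuousLinearMap.single ℂ (fun _ : ι => ι → WeakDual ℂ V) i))
    (fun j => Pi.single j (f i j)) Finset.univ

theorem exists_complex_functional_separating {E : Type*} [AddCommGroup E] [TopologicalSpace E]
    [IsTopologicalAddGroup E] [Module ℂ E] [ContinuousSMul ℂ E] [LocallyConvexSpace ℝ E]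
    {C : Set E} (hconv : ∀ x ∈ C, ∀ y ∈ C, ∀ a b : ℝ, 0 ≤ a → 0 ≤ b → a + b = 1 →
      (a : ℂ) • x + (b : ℂ) • y ∈ C) (hC : IsClosed C) {y : E} (hy : y ∉ C) :
    ∃ (g : StrongDual ℂ E) (r : ℝ), (∀ x ∈ C, (g x).re < r) ∧ r < (g y).re :=
  RCLike.geometric_hahn_banach_closed_point (𝕜 := ℂ) (E := E)
    (fun x hx y hy a b ha hb hab => hconv x hx y hy a b ha hb hab) hC hy

theorem locallyConvexSpace_weakDual :
    @LocallyConvexSpace ℝ (WeakDual ℂ V) _ _ _ (Module.complexToReal _) _ := by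
  exact @WeakBilin.locallyConvexSpace ℂ (StrongDual ℂ V) V _ _ _ _ _ _
    (Module.complexToReal _) _ (topDualPairing ℂ V)

theorem locallyConvexSpace_pi_weakDual (ι : Type*) :
    @LocallyConvexSpace ℝ (ι → ι → WeakDual ℂ V) _ _ _ (Module.complexToReal _) _ :=
  @Pi.locallyConvexSpace ℝ _ _ ι (fun _ => ι → WeakDual ℂ V) _ _ (fun _ => Module.complexToReal _)
    fun _ => @Pi.locallyConvexSpace ℝ _ _ ι (fun _ => WeakDual ℂ V) _ _
      (fun _ => Module.complexToReal _) fun _ => locallyConvexSpace_weakDual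

end

namespace CBMatrix

variable {V : Type v} [NormedAddCommGroup V] [NormedSpace ℂ V] [OperatorSpace V] {I : Type u}

/-- The matrix over `I` with the given entries in the block `s × s`, and zeros elsewhere. -/
noncomputable def ofEntries (s : Finset I) (f : s → s → StrongDual ℂ V) : CBMatrix V I :=
  ⟨∑ i, ∑ j, rankOneMap (f i j : V →ₗ[ℂ] ℂ) (stdVec i.1) (stdVec j.1),
    CompletelyBounded.sum _ _ fun _ _ => CompletelyBounded.sum _ _ fun _ _ =>
      ⟨_, cbBound_rankOneMap _ _ _⟩⟩

theorem ofEntries_toMap (s : Finset I) (f : s → s → StrongDual ℂ V) (v : V) :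
    (ofEntries s f).toMap v = ∑ i, ∑ j, f i j v • rankOne ℂ (stdVec i.1) (stdVec j.1) := by
  simp [ofEntries, toMap, rankOneMap, LinearMap.sum_apply]

/-- A truncation depends only on finitely many entries in E, which moves the separation problem to a
finite power of E with its weak* topology. -/
theorem compress_coordProj (x : CBMatrix V I) (s : Finset I) :
    x.compress (coordProj s) = ofEntries s fun i j => x.entry i j := by
  refine toMap_ext fun v => ?_
  ext1 ξ
  rw [ofEntries_toMap, compress_toMap, adjoint_coordProj, ContinuousLinearMap.comp_apply,
    ContinuousLinearMap.comp_apply, coordProj_apply, coordProj_apply, ← Finset.sum_coe_sort s,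
    ← Finset.sum_coe_sort s, map_sum, sum_apply]
  refine Finset.sum_congr rfl fun i _ => ?_
  rw [← inner_stdVec_left, inner_sum, Finset.sum_smul, sum_apply]
  refine Finset.sum_congr rfl fun j _ => ?_
  rw [map_smul, inner_smul_right, entry_apply, smul_apply, rankOne_apply,
    inner_stdVec_left j.1, smul_smul, mul_comm]

theorem continuous_ofEntries (s : Finset I) :
    Continuous fun f : s → s → WeakDual ℂ V =>
      ofEntries s fun i j => WeakDual.toStrongDual (f i j) := by
  rw [continuous_iff]
  intro v
  rw [continuous_weakStar_iff]
  intro ξ η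
  simp only [ofEntries_toMap, map_sum, map_smul, smul_eq_mul]
  refine continuous_finsetSum _ fun i _ => continuous_finsetSum _ fun j _ => ?_
  refine Continuous.mul ?_ continuous_const
  exact (WeakDual.eval_continuous v).comp ((continuous_apply j).comp (continuous_apply i))

theorem tendsto_compress_coordProj (x : CBMatrix V I) :
    Filter.Tendsto (fun s => x.compress (coordProj s)) Filter.atTop (nhds x) := by
  rw [tendsto_iff]
  intro v
  refine (tendsto_coordProj_conj (x.toMap v)).congr fun s => ?_
  rw [compress_toMap, adjoint_coordProj]

end CBMatrix

theorem exists_separating_functional {V : Type v} [NormedAddCommGroup V] [NormedSpace ℂ V]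
    [OperatorSpace V] {κ : Cardinal.{u}} (hκ : ℵ₀ ≤ κ)
    {K : ∀ I : Type u, Set (CBMatrix V I)} (hK : IsNCConvex κ K) (hKc : IsNCClosed κ K)
    (h0 : (0 : CBMatrix V PUnit.{u + 1}) ∈ K PUnit.{u + 1})
    (n : Type u) [Nonempty n] (hn : #n ≤ κ) (y : CBMatrix V n) (hy : y ∉ K n) :
    ∃ (s : Finset n) (v : s → s → V),
      (∀ x ∈ K n, (∑ i, ∑ j, x.entry i.1 j.1 (v i j)).re ≤ 1) ∧
        1 < (∑ i, ∑ j, y.entry i.1 j.1 (v i j)).re := by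
  obtain ⟨s, hs⟩ : ∃ s : Finset n, y.compress (coordProj s) ∉ K n := by
    by_contra! h
    exact hy ((hKc n hn).mem_of_tendsto y.tendsto_compress_coordProj (.of_forall h))
  let mk : (s → s → WeakDual ℂ V) → CBMatrix V n := fun f =>
    CBMatrix.ofEntries s fun i j => WeakDual.toStrongDual (f i j)
  have hclosed : IsClosed (mk ⁻¹' K n) :=
    (hKc n hn).preimage (CBMatrix.continuous_ofEntries s)
  let ent : CBMatrix V n → s → s → WeakDual ℂ V := fun x i j =>
    StrongDual.toWeakDual (x.entry i.1 j.1)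
  have hent : ∀ x, mk (ent x) = x.compress (coordProj s) := fun x =>
    (x.compress_coordProj s).symm
  have hy' : ent y ∉ mk ⁻¹' K n := by
    rw [Set.mem_preimage, hent]
    exact hs
  have hconv : ∀ f ∈ mk ⁻¹' K n, ∀ g ∈ mk ⁻¹' K n, ∀ a b : ℝ, 0 ≤ a → 0 ≤ b → a + b = 1 →
      (a : ℂ) • f + (b : ℂ) • g ∈ mk ⁻¹' K n := by
    intro f hf g hg a b ha hb hab
    refine hK.convex_comb_mem hκ hn hf hg ha hb hab fun v => ?_
    simp only [mk, CBMatrix.ofEntries_toMap, Finset.smul_sum, ← Finset.sum_add_distrib, smul_smul,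
      ← add_smul]
    refine Finset.sum_congr rfl fun i _ => Finset.sum_congr rfl fun j _ => ?_
    congr 1
  have := locallyConvexSpace_pi_weakDual (V := V) s
  obtain ⟨g, r, hg, hr⟩ := exists_complex_functional_separating hconv hclosed hy'
  obtain ⟨v, hv⟩ := exists_eq_sum_eval g
  -- Zero lies in the convex set, so the separating level is positive and can be rescaled to 1.
  have hr0 : 0 < r := by
    have := hg 0 (by
      rw [Set.mem_preimage]
      convert hK.zero_mem hκ h0 n hn using 1
      refine CBMatrix.toMap_ext fun v => ?_
      simp [mk, CBMatrix.ofEntries_toMap, CBMatrix.zero_toMap])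
    simpa using this
  have hscale : ∀ x : CBMatrix V n, (∑ i, ∑ j, x.entry i.1 j.1 (((r⁻¹ : ℝ) : ℂ) • v i j)).re
      = r⁻¹ * (g (ent x)).re := fun x => by
    rw [hv, ← Complex.re_ofReal_mul]
    simp only [map_smul, smul_eq_mul, Finset.mul_sum]
    rfl
  refine ⟨s, fun i j => ((r⁻¹ : ℝ) : ℂ) • v i j, fun x hx => ?_, ?_⟩
  · rw [hscale, inv_mul_le_iff₀ hr0, mul_one]
    refine (hg (ent x) ?_).le
    rw [Set.mem_preimage, hent]
    exact hK.compress_mem hκ h0 hn hn hx _ (norm_coordProj_le s)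
  · rw [hscale, lt_inv_mul_iff₀ hr0, mul_one]
    exact hr

/-! ### Columns compressing a direct sum -/

section DirectSum

variable {V : Type v} [NormedAddCommGroup V] [NormedSpace ℂ V] [OperatorSpace V] {I J L : Type u}

theorem adjoint_inlCLM_apply_inlCLM (ξ : Hil I) :
    ContinuousLinearMap.adjoint (inlCLM I J) (inlCLM I J ξ) = ξ :=
  congrArg (· ξ) adjoint_inl_comp_inl

theorem adjoint_inrCLM_apply_inlCLM (ξ : Hil I) :
    ContinuousLinearMap.adjoint (inrCLM I J) (inlCLM I J ξ) = 0 :=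
  congrArg (fun T : Hil I →L[ℂ] Hil J => T ξ) adjoint_inr_comp_inl

theorem adjoint_inlCLM_apply_inrCLM (ξ : Hil J) :
    ContinuousLinearMap.adjoint (inlCLM I J) (inrCLM I J ξ) = 0 :=
  congrArg (fun T : Hil J →L[ℂ] Hil I => T ξ) adjoint_inl_comp_inr

theorem adjoint_inrCLM_apply_inrCLM (ξ : Hil J) :
    ContinuousLinearMap.adjoint (inrCLM I J) (inrCLM I J ξ) = ξ :=
  congrArg (· ξ) adjoint_inr_comp_inr

/-- The column `(α, β) : ℓ²(L) → ℓ²(I) ⊕ ℓ²(J)`. -/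
noncomputable def columnCLM (α : Hil L →L[ℂ] Hil I) (β : Hil L →L[ℂ] Hil J) :
    Hil L →L[ℂ] Hil (I ⊕ J) :=
  inlCLM I J ∘L α + inrCLM I J ∘L β

theorem adjoint_columnCLM_comp_self (α : Hil L →L[ℂ] Hil I) (β : Hil L →L[ℂ] Hil J) :
    ContinuousLinearMap.adjoint (columnCLM α β) ∘L columnCLM α β
      = ContinuousLinearMap.adjoint α ∘L α + ContinuousLinearMap.adjoint β ∘L β := by
  ext1 ξ
  simp [columnCLM, ContinuousLinearMap.adjoint_comp, adjoint_inlCLM_apply_inlCLM,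
    adjoint_inrCLM_apply_inlCLM, adjoint_inlCLM_apply_inrCLM, adjoint_inrCLM_apply_inrCLM]

theorem compress_columnCLM_directSum (x : CBMatrix V I) (y : CBMatrix V J)
    (α : Hil L →L[ℂ] Hil I) (β : Hil L →L[ℂ] Hil J) :
    (x.directSum y).compress (columnCLM α β) = x.compress α + y.compress β := by
  refine CBMatrix.toMap_ext fun v => ?_
  ext1 ξ
  simp [columnCLM, CBMatrix.directSum, CBMatrix.add_toMap, CBMatrix.compress_toMap,
    ContinuousLinearMap.adjoint_comp, adjoint_inlCLM_apply_inlCLM,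
    adjoint_inrCLM_apply_inlCLM, adjoint_inlCLM_apply_inrCLM, adjoint_inrCLM_apply_inrCLM]

end DirectSum

/-- The Hahn-Banach theorem for the sublinear function `A ↦ inf S(A)`. -/
theorem exists_linear_le_of_sublinear_sets {E : Type*} [AddCommGroup E] [Module ℝ E]
    (S : E → Set ℝ) (hne : ∀ A, (S A).Nonempty) (hbdd : ∀ A, BddBelow (S A))
    (h0 : ∀ r ∈ S 0, 0 ≤ r)
    (hsmul : ∀ c : ℝ, 0 < c → ∀ A, ∀ r ∈ S A, c * r ∈ S (c • A))
    (hadd : ∀ A B, ∀ r ∈ S A, ∀ r' ∈ S B, r + r' ∈ upperClosure (S (A + B))) :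
    ∃ g : E →ₗ[ℝ] ℝ, ∀ A, ∀ r ∈ S A, g A ≤ r := by
  have hle : ∀ A, ∀ c : ℝ, 0 < c → sInf (S (c • A)) ≤ c * sInf (S A) := fun A c hc => by
    rw [← inv_mul_le_iff₀ hc]
    refine le_csInf (hne A) fun r hr => ?_
    rw [inv_mul_le_iff₀ hc]
    exact csInf_le (hbdd _) (hsmul c hc A r hr)
  have hhom : ∀ c : ℝ, 0 < c → ∀ A, sInf (S (c • A)) = c * sInf (S A) := fun c hc A => by
    refine le_antisymm (hle A c hc) ?_
    have := hle (c • A) c⁻¹ (inv_pos.2 hc)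
    rw [smul_smul, inv_mul_cancel₀ hc.ne', one_smul, le_inv_mul_iff₀ hc] at this
    exact this
  have hsub : ∀ A B, sInf (S (A + B)) ≤ sInf (S A) + sInf (S B) := fun A B => by
    rw [← sub_le_iff_le_add]
    refine le_csInf (hne A) fun r hr => ?_
    rw [sub_le_comm]
    refine le_csInf (hne B) fun r' hr' => ?_
    obtain ⟨t, ht, htr⟩ := hadd A B r hr r' hr'
    have := csInf_le (hbdd _) ht
    linarith
  -- The extension starts from the zero functional on the zero subspace.
  have hbot : ∀ x : (⊥ : E →ₗ.[ℝ] ℝ).domain, (⊥ : E →ₗ.[ℝ] ℝ) x ≤ sInf (S x) := by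
    rintro ⟨x, hx⟩
    have hx' : x = 0 := hx
    subst hx'
    have h : (⊥ : E →ₗ.[ℝ] ℝ) ⟨0, hx⟩ = 0 := LinearPMap.map_zero _
    rw [h]
    exact le_csInf (hne 0) h0
  obtain ⟨g, -, hg⟩ := exists_extension_of_le_sublinear (⊥ : E →ₗ.[ℝ] ℝ) (fun A => sInf (S A))
    hhom hsub hbot
  exact ⟨g, fun A r hr => (hg A).trans (csInf_le (hbdd A) hr)⟩

/-! ### Domination of the scalar functional by a positive matrix -/

section Domination

variable {V : Type v} [NormedAddCommGroup V] [NormedSpace ℂ V] [OperatorSpace V]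
  {κ : Cardinal.{u}} {K : ∀ I : Type u, Set (CBMatrix V I)} {n : Type u}

/-- The functional `x ↦ ∑ x_ij(v_ij)`. -/
noncomputable def entrySum {s : Finset n} (v : s → s → V) (x : CBMatrix V n) : ℂ :=
  ∑ i, ∑ j, x.entry i.1 j.1 (v i j)

theorem entrySum_compress {s : Finset n} (v : s → s → V) {p : Type u} (x : CBMatrix V p)
    (α : Hil n →L[ℂ] Hil p) : entrySum v (x.compress α)
      = ∑ i : s, ∑ j : s, inner ℂ (α (stdVec i.1)) (x.toMap (v i j) (α (stdVec j.1))) := by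
  refine Finset.sum_congr rfl fun i _ => Finset.sum_congr rfl fun j _ => ?_
  rw [CBMatrix.entry_apply, CBMatrix.inner_compress]

theorem entrySum_add {s : Finset n} (v : s → s → V) (x y : CBMatrix V n) :
    entrySum v (x + y) = entrySum v x + entrySum v y := by
  simp only [entrySum, CBMatrix.entry_apply, CBMatrix.add_toMap, add_apply, inner_add_right,
    Finset.sum_add_distrib]

theorem entrySum_compress_smul {s : Finset n} (v : s → s → V) {p : Type u} (x : CBMatrix V p)
    (α : Hil n →L[ℂ] Hil p) (c : ℝ) :
    entrySum v (x.compress ((c : ℂ) • α)) = ((c ^ 2 : ℝ) : ℂ) * entrySum v (x.compress α) := by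
  rw [entrySum_compress, entrySum_compress, Finset.mul_sum]
  refine Finset.sum_congr rfl fun i _ => ?_
  rw [Finset.mul_sum]
  refine Finset.sum_congr rfl fun j _ => ?_
  simp only [smul_apply, map_smul, inner_smul_left, inner_smul_right, Complex.conj_ofReal]
  push_cast
  ring

/-- Both sides are quadratic in α, so the case of a contraction suffices, and K is stable under
contractive compressions. -/
theorem entrySum_compress_le (hK : IsNCConvex κ K) (hκ : ℵ₀ ≤ κ)
    (h0 : (0 : CBMatrix V PUnit.{u + 1}) ∈ K PUnit.{u + 1}) [Nonempty n] (hn : #n ≤ κ)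
    {s : Finset n} {v : s → s → V} (hv : ∀ x ∈ K n, (entrySum v x).re ≤ 1)
    {p : Type u} [Nonempty p] (hp : #p ≤ κ) {x : CBMatrix V p} (hx : x ∈ K p)
    (α : Hil n →L[ℂ] Hil p) : (entrySum v (x.compress α)).re ≤ ‖α‖ ^ 2 := by
  rcases (norm_nonneg α).eq_or_lt with h | h
  · rw [eq_comm, norm_eq_zero] at h
    subst h
    simp [entrySum_compress]
  · have h1 := hv _ (hK.compress_mem hκ h0 hp hn hx (((‖α‖⁻¹ : ℝ) : ℂ) • α) (by
      rw [norm_smul, Complex.norm_real, norm_inv, norm_norm, inv_mul_cancel₀ h.ne']))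
    rw [entrySum_compress_smul, Complex.re_ofReal_mul, inv_pow,
      inv_mul_le_iff₀ (by positivity), mul_one] at h1
    exact h1

/-- The bound by ‖α‖², which depends on α^*α only through its norm, is replaced by one linear in
α^*α. The direct sums in K play the role of convexity. -/
theorem exists_dominating_functional (hK : IsNCConvex κ K) (hκ : ℵ₀ ≤ κ)
    (h0 : (0 : CBMatrix V PUnit.{u + 1}) ∈ K PUnit.{u + 1}) [Nonempty n] (hn : #n ≤ κ)
    {s : Finset n} {v : s → s → V} (hv : ∀ x ∈ K n, (entrySum v x).re ≤ 1) :
    ∃ g : MM n →ₗ[ℝ] ℝ, (∀ A, g A ≤ ‖A‖) ∧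
      ∀ (p : Type u) [Nonempty p], #p ≤ κ → ∀ x ∈ K p, ∀ α : Hil n →L[ℂ] Hil p,
        (entrySum v (x.compress α)).re ≤ g (ContinuousLinearMap.adjoint α ∘L α) := by
  let S : MM n → Set ℝ := fun A => {r | ∃ (p : Type u) (_ : Nonempty p) (_ : #p ≤ κ),
    ∃ x ∈ K p, ∃ α : Hil n →L[ℂ] Hil p,
      r = ‖A + ContinuousLinearMap.adjoint α ∘L α‖ - (entrySum v (x.compress α)).re}
  -- Finiteness of the infimum: ‖A + α^*α‖ ≥ ‖α‖² - ‖A‖, while the subtracted term is at most ‖α‖².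
  have hbd : ∀ A, ∀ r ∈ S A, -‖A‖ ≤ r := by
    rintro A r ⟨p, _, hp, x, hx, α, rfl⟩
    have h1 := entrySum_compress_le hK hκ h0 hn hv hp hx α
    have h2 := norm_sub_le (A + ContinuousLinearMap.adjoint α ∘L α) A
    rw [add_sub_cancel_left, ContinuousLinearMap.norm_adjoint_comp_self, ← sq] at h2
    linarith
  obtain ⟨g, hg⟩ := exists_linear_le_of_sublinear_sets S
    (fun A => ⟨_, n, ‹_›, hn, 0, hK.zero_mem hκ h0 n hn, 0, rfl⟩)
    (fun A => ⟨-‖A‖, fun r hr => hbd A r hr⟩) (fun r hr => by simpa using hbd 0 r hr)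
    (by
      rintro c hc A _ ⟨p, hp0, hp, x, hx, α, rfl⟩
      refine ⟨p, hp0, hp, x, hx, ((√c : ℝ) : ℂ) • α, ?_⟩
      rw [entrySum_compress_smul, Real.sq_sqrt hc.le, Complex.re_ofReal_mul, mul_sub]
      congr 1
      rw [map_smulₛₗ, Complex.conj_ofReal, ContinuousLinearMap.comp_smul,
        ContinuousLinearMap.smul_comp, smul_smul, ← Complex.ofReal_mul, Real.mul_self_sqrt hc.le]
      have h : c • A + (c : ℂ) • (ContinuousLinearMap.adjoint α ∘L α)
          = (c : ℂ) • (A + ContinuousLinearMap.adjoint α ∘L α) := by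
        rw [smul_add]
        congr 1
      rw [h, norm_smul, Complex.norm_real, Real.norm_of_nonneg hc.le])
    (by
      rintro A B _ ⟨p, hp0, hp, x, hx, α, rfl⟩ _ ⟨q, hq0, hq, y, hy, β, rfl⟩
      refine ⟨_, ⟨p ⊕ q, inferInstance, ?_, _, hK.directSum_mem hκ hp hq hx hy, columnCLM α β,
        rfl⟩, ?_⟩
      · rw [← Cardinal.add_def]
        exact Cardinal.add_le_of_le hκ hp hq
      · rw [compress_columnCLM_directSum, entrySum_add, adjoint_columnCLM_comp_self, Complex.add_re]
        have h := norm_add_le (A + ContinuousLinearMap.adjoint α ∘L α)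
          (B + ContinuousLinearMap.adjoint β ∘L β)
        rw [add_add_add_comm] at h
        linarith)
  refine ⟨g, fun A => ?_, fun p _ hp x hx α => ?_⟩
  · refine hg A _ ⟨n, ‹_›, hn, 0, hK.zero_mem hκ h0 n hn, 0, ?_⟩
    simp [entrySum_compress]
  · have h := hg (-(ContinuousLinearMap.adjoint α ∘L α)) _ ⟨p, ‹_›, hp, x, hx, α, rfl⟩
    rw [neg_add_cancel, norm_zero, map_neg] at h
    linarith

open scoped ComplexOrder in
theorem exists_dominating_matrix (hK : IsNCConvex κ K) (hκ : ℵ₀ ≤ κ)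
    (h0 : (0 : CBMatrix V PUnit.{u + 1}) ∈ K PUnit.{u + 1}) [Nonempty n] (hn : #n ≤ κ)
    {s : Finset n} {v : s → s → V} (hv : ∀ x ∈ K n, (entrySum v x).re ≤ 1) :
    ∃ D : Matrix s s ℂ, D.PosSemidef ∧ D.trace.re ≤ 1 ∧
      ∀ (p : Type u) [Nonempty p], #p ≤ κ → ∀ x ∈ K p, ∀ a : s → Hil p,
        (∑ i, ∑ j, inner ℂ (a i) (x.toMap (v i j) (a j))).re
          ≤ (∑ i, ∑ j, D i j * inner ℂ (a i) (a j)).re := by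
  obtain ⟨g, hg1, hg2⟩ := exists_dominating_functional hK hκ h0 hn hv
  let E : s → s → MM n := fun i j => rankOne ℂ (stdVec i.1) (stdVec j.1)
  -- The real-linear g is the real part of a complex-linear functional; D₀ holds the values of that
  -- functional at the matrix units.
  let D₀ : Matrix s s ℂ := Matrix.of fun i j => ⟨g (E i j), -g (Complex.I • E i j)⟩
  have hD₀ : ∀ i j (c : ℂ), (D₀ i j * c).re = g (c • E i j) := fun i j c => by
    have h : c • E i j = c.re • E i j + c.im • (Complex.I • E i j) := by
      conv_lhs => rw [← Complex.re_add_im c, add_smul, mul_smul]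
      rfl
    rw [h, map_add, map_smul, map_smul]
    simp [D₀]
    ring
  have hsum : ∀ G : Matrix s s ℂ, (∑ i, ∑ j, D₀ i j * G i j).re
      = g (∑ i, ∑ j, G i j • E i j) := fun G => by
    simp only [Complex.re_sum, map_sum, hD₀]
  -- Only Gram matrices and the identity are paired with D₀. These are hermitian, so the real parts
  -- of the pairings see only the hermitian part of D₀.
  let D : Matrix s s ℂ := (2⁻¹ : ℂ) • (D₀ + D₀.conjTranspose)
  have hDH : D.IsHermitian := by
    simp [D, Matrix.IsHermitian, Matrix.conjTranspose_smul, add_comm]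
  have hDsum : ∀ G : Matrix s s ℂ, G.IsHermitian →
      (∑ i, ∑ j, D i j * G i j).re = (∑ i, ∑ j, D₀ i j * G i j).re := fun G hG => by
    have h1 : ∑ i, ∑ j, D₀.conjTranspose i j * G i j = star (∑ i, ∑ j, D₀ i j * G i j) := by
      rw [Finset.sum_comm, star_sum]
      refine Finset.sum_congr rfl fun i _ => ?_
      rw [star_sum]
      refine Finset.sum_congr rfl fun j _ => ?_
      rw [Matrix.conjTranspose_apply, StarMul.star_mul, mul_comm, hG.apply]
    have h2 : ∑ i, ∑ j, D i j * G i j = 2⁻¹ * (∑ i, ∑ j, D₀ i j * G i j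
        + ∑ i, ∑ j, D₀.conjTranspose i j * G i j) := by
      simp only [D, Matrix.smul_apply, Matrix.add_apply, smul_eq_mul, Finset.mul_sum, mul_add,
        ← Finset.sum_add_distrib, add_mul, mul_assoc]
    rw [h2, h1]
    simp
    ring
  have hdom : ∀ (p : Type u) [Nonempty p], #p ≤ κ → ∀ x ∈ K p, ∀ a : s → Hil p,
      (∑ i, ∑ j, inner ℂ (a i) (x.toMap (v i j) (a j))).re
        ≤ (∑ i, ∑ j, D i j * inner ℂ (a i) (a j)).re := by
    intro p _ hp x hx a
    have hG : (Matrix.of fun i j => (inner ℂ (a i) (a j) : ℂ)).IsHermitian := by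
      ext i j
      simp
    have h1 := hDsum _ hG
    have h2 := hsum (Matrix.of fun i j => (inner ℂ (a i) (a j) : ℂ))
    simp only [Matrix.of_apply] at h1 h2
    rw [h1, h2]
    -- This α sends e_i to a_i, and α^*α = ∑ ⟪a_i, a_j⟫ E_ij.
    let α : Hil n →L[ℂ] Hil p := ∑ i : s, rankOne ℂ (a i) (stdVec i.1)
    have hα : ∀ i : s, α (stdVec i.1) = a i := fun i => by
      simp only [α, sum_apply, rankOne_apply]
      rw [Finset.sum_eq_single_of_mem i (Finset.mem_univ i)]
      · rw [inner_stdVec_left, stdVec_apply_self, one_smul]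
      · intro j _ hj
        rw [inner_stdVec_left, stdVec_apply_ne (fun h => hj (Subtype.ext h)), zero_smul]
    have h3 := hg2 p hp x hx α
    simp only [entrySum_compress, hα] at h3
    refine h3.trans (le_of_eq (congrArg g ?_))
    ext1 ξ
    simp [α, E, sum_apply, Finset.smul_sum, inner_stdVec_left, smul_smul]
    rw [Finset.sum_comm]
    exact Finset.sum_congr rfl fun i _ => Finset.sum_congr rfl fun j _ => by rw [mul_comm]
  refine ⟨D, .of_dotProduct_mulVec_nonneg hDH fun c => ?_, ?_, hdom⟩
  · obtain ⟨k⟩ := ‹Nonempty n›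
    -- Positivity of D is the domination for x = 0 with all vectors a_i on one line.
    have h := hdom n hn 0 (hK.zero_mem hκ h0 n hn) fun i => c i • stdVec k
    have h1 : ∑ i, ∑ j, D i j * inner ℂ (c i • stdVec k) (c j • stdVec k)
        = star c ⬝ᵥ D.mulVec c := by
      simp only [dotProduct, Matrix.mulVec, Finset.mul_sum]
      refine Finset.sum_congr rfl fun i _ => Finset.sum_congr rfl fun j _ => ?_
      rw [inner_smul_left, inner_smul_right, inner_stdVec_left, stdVec_apply_self]
      simp
      ring
    rw [h1] at h
    have h2 := hDH.im_star_dotProduct_mulVec_self c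
    rw [Complex.nonneg_iff]
    refine ⟨?_, h2.symm⟩
    simpa [CBMatrix.zero_toMap] using h
  · classical
    -- The trace is the value of g at the projection P_s, whose norm is at most 1.
    have h1 := hDsum 1 Matrix.isHermitian_one
    have h2 := hsum 1
    have h3 : ∑ i, ∑ j, D i j * (1 : Matrix s s ℂ) i j = D.trace := by
      simp [Matrix.one_apply, Matrix.trace]
    have h4 : ∑ i, ∑ j, (1 : Matrix s s ℂ) i j • E i j = coordProj s := by
      rw [coordProj, ← Finset.sum_coe_sort s]
      refine Finset.sum_congr rfl fun i _ => ?_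
      simp [Matrix.one_apply, E]
    rw [← h3, h1, h2, h4]
    exact (hg1 _).trans (norm_coordProj_le s)

end Domination

/-! ### Finite rank maps E → M_n and their amplifications -/

section Amplification

variable {p n : Type u}

/-- The map `ξ ↦ ξ ⊗ w`. -/
noncomputable def tensorRight (p : Type u) (w : Hil n) : Hil p →L[ℂ] HilTensor p n :=
  LinearMap.mkContinuous
    { toFun := fun ξ => ⟨fun k => ξ k • w, memℓp_gen <| by
        have := (lp.memℓp ξ).summable (by norm_num)
        simp_rw [norm_smul, Real.mul_rpow (norm_nonneg _) (norm_nonneg _)]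
        exact this.mul_right _⟩
      map_add' := fun ξ η => by ext k : 2; exact add_smul _ _ _
      map_smul' := fun c ξ => by ext k : 2; exact mul_smul _ _ _ } ‖w‖ fun ξ => by
    refine lp.norm_le_of_forall_sum_le (by norm_num) (by positivity) fun s => ?_
    have := lp.sum_rpow_le_norm_rpow (p := 2) (by norm_num) ξ s
    simp only [LinearMap.coe_mk, AddHom.coe_mk, norm_smul,
      Real.mul_rpow (norm_nonneg _) (norm_nonneg _)] at this ⊢
    rw [← Finset.sum_mul, mul_comm]
    exact mul_le_mul_of_nonneg_left this (by positivity)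

theorem tensorRight_apply (w : Hil n) (ξ : Hil p) (k : p) : tensorRight p w ξ k = ξ k • w := rfl

theorem adjoint_tensorRight_apply (w : Hil n) (ζ : HilTensor p n) (k : p) :
    ContinuousLinearMap.adjoint (tensorRight p w) ζ k = inner ℂ w (ζ k) := by
  classical
  rw [← inner_stdVec_left, ContinuousLinearMap.adjoint_inner_right]
  have h : tensorRight p w (stdVec k) = lp.single 2 k w := by
    ext j : 2
    rw [tensorRight_apply]
    by_cases hj : j = k
    · subst hj
      rw [stdVec_apply_self, one_smul, lp.single_apply_self]
    · rw [stdVec_apply_ne hj, zero_smul, lp.single_apply_ne _ _ _ hj]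
  rw [h, lp.inner_single_left]

variable {V : Type v} [NormedAddCommGroup V] [NormedSpace ℂ V] [OperatorSpace V]

/-- The finite rank map `e ↦ ∑ e(v_ij) |w_i⟩⟨w_j|`. -/
noncomputable def finiteRankMap {ι : Type*} [Fintype ι] (v : ι → ι → V) (w : ι → Hil n) :
    StrongDual ℂ V →ₗ[ℂ] MM n :=
  ∑ i, ∑ j, rankOneMap (NormedSpace.inclusionInDoubleDual ℂ V (v i j) : StrongDual ℂ V →ₗ[ℂ] ℂ)
    (w i) (w j)

/-- The amplification of `finiteRankMap v w`. -/
noncomputable def finiteRankAmplification {ι : Type*} [Fintype ι] (v : ι → ι → V) (w : ι → Hil n)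
    (x : CBMatrix V p) : HilTensor p n →L[ℂ] HilTensor p n :=
  ∑ i, ∑ j, tensorRight p (w i) ∘L x.toMap (v i j)
    ∘L ContinuousLinearMap.adjoint (tensorRight p (w j))

section

variable {ι : Type*} [Fintype ι] (v : ι → ι → V) (w : ι → Hil n)

omit [OperatorSpace V] in
theorem finiteRankMap_apply (e : StrongDual ℂ V) :
    finiteRankMap v w e = ∑ i, ∑ j, e (v i j) • rankOne ℂ (w i) (w j) := by
  simp [finiteRankMap, rankOneMap, LinearMap.sum_apply]

theorem isAmplification_finiteRank (x : CBMatrix V p) :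
    IsAmplification (finiteRankMap v w) x (finiteRankAmplification v w x) := by
  classical
  intro k l ξ
  have h : ∀ w : Hil n, ContinuousLinearMap.adjoint (tensorRight p w)
      (lp.single 2 l ξ : HilTensor p n) = inner ℂ w ξ • stdVec l := fun w => by
    ext k
    rw [adjoint_tensorRight_apply]
    change _ = inner ℂ w ξ * stdVec l k
    by_cases hk : k = l
    · subst hk
      rw [lp.single_apply_self, stdVec_apply_self, mul_one]
    · rw [lp.single_apply_ne _ _ _ hk, stdVec_apply_ne hk, inner_zero_right, mul_zero]
  rw [finiteRankMap_apply]
  -- The two sides differ only in the decidability instance.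
  have e : (lp.single 2 l ξ : HilTensor p n) =
    @lp.single p (fun _ => Hil n) _ (fun a b => Classical.propDecidable (a = b)) 2 l ξ := by
    congr
  rw [← e]
  simp only [finiteRankAmplification, sum_apply, ContinuousLinearMap.comp_apply, h, map_smul,
    lp.coeFn_sum, Finset.sum_apply]
  refine Finset.sum_congr rfl fun i _ => Finset.sum_congr rfl fun j _ => ?_
  rw [CBMatrix.entry_apply, inner_stdVec_left, smul_apply, rankOne_apply, smul_smul, mul_comm,
    mul_smul]
  rfl

omit [OperatorSpace V] in
theorem isNormalMap_finiteRankMap : IsNormalMap (finiteRankMap v w) := by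
  rw [IsNormalMap, continuous_weakStar_iff]
  intro ξ η
  simp only [finiteRankMap_apply, map_sum, map_smul, smul_eq_mul]
  refine continuous_finsetSum _ fun i _ => continuous_finsetSum _ fun j _ => ?_
  exact (WeakDual.eval_continuous (v i j)).mul continuous_const

theorem completelyBounded_finiteRankMap :
    CompletelyBounded (dualMatrixNorm V) (cstarMatrixNorm (MM n)) (finiteRankMap v w) :=
  CompletelyBounded.sum _ _ fun _ _ => CompletelyBounded.sum _ _ fun _ _ =>
    ⟨_, cbBound_dual_rankOneMap _ _ _⟩

theorem inner_finiteRankAmplification (x : CBMatrix V p) (ζ : HilTensor p n) :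
    inner ℂ ζ (finiteRankAmplification v w x ζ) = ∑ i, ∑ j,
      inner ℂ (ContinuousLinearMap.adjoint (tensorRight p (w i)) ζ)
        (x.toMap (v i j) (ContinuousLinearMap.adjoint (tensorRight p (w j)) ζ)) := by
  simp only [finiteRankAmplification, sum_apply, inner_sum, ContinuousLinearMap.comp_apply,
    ContinuousLinearMap.adjoint_inner_left]

end

theorem realPart_le_one_iff {H : Type*} [NormedAddCommGroup H] [InnerProductSpace ℂ H]
    [CompleteSpace H] (T : H →L[ℂ] H) :
    (realPart T : H →L[ℂ] H) ≤ 1 ↔ ∀ ζ : H, (inner ℂ ζ (T ζ)).re ≤ ‖ζ‖ ^ 2 := by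
  rw [ContinuousLinearMap.le_def, ContinuousLinearMap.isPositive_def',
    and_iff_right ((IsSelfAdjoint.one _).sub (realPart T).2)]
  refine forall_congr' fun ζ => ?_
  have h : (inner ℂ ((realPart T : H →L[ℂ] H) ζ) ζ).re = (inner ℂ ζ (T ζ)).re := by
    rw [realPart_apply_coe, smul_apply, add_apply, ContinuousLinearMap.star_eq_adjoint]
    change (inner ℂ (((2⁻¹ : ℝ) : ℂ) • (T ζ + ContinuousLinearMap.adjoint T ζ)) ζ).re = _
    rw [inner_smul_left, Complex.conj_ofReal, Complex.re_ofReal_mul, inner_add_left,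
      ContinuousLinearMap.adjoint_inner_left, Complex.add_re, ← inner_conj_symm, Complex.conj_re]
    ring
  rw [ContinuousLinearMap.reApplyInnerSelf_apply, sub_apply, inner_sub_left, one_apply_eq_self,
    map_sub, inner_self_eq_norm_sq, sub_nonneg]
  change (inner ℂ ((realPart T : H →L[ℂ] H) ζ) ζ).re ≤ _ ↔ _
  rw [h]

end Amplification

/-! ### Biorthogonal vectors from a factorization D = B^*B -/

section Factorization

variable {n : Type u} {s : Finset n}

open scoped ComplexOrder MatrixOrder Matrix.Norms.L2Operator in
-- The w_i are the conjugated rows of B⁻¹ and the u_k the columns of B, viewed in ℓ²(n). For c =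
-- B⁻¹η on the block, the D-form at c is ‖Bc‖² = ‖P_s η‖², while ∑ ‖u_k‖² = tr B^*B.
theorem exists_biorthogonal_of_posDef {D : Matrix s s ℂ} (hD : D.PosDef) :
    ∃ w u : s → Hil n,
      (∀ η : Hil n, (∑ i, ∑ j, D i j * (star (inner ℂ (w i) η) * inner ℂ (w j) η)).re
        ≤ ‖η‖ ^ 2) ∧
      (∀ j, inner ℂ (w j) (u j) = (1 : ℂ)) ∧ (∀ j k, j ≠ k → inner ℂ (w j) (u k) = (0 : ℂ)) ∧
      ∑ k, ‖u k‖ ^ 2 = D.trace.re := by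
  classical
  obtain ⟨B, hB⟩ : ∃ B : Matrix s s ℂ, D = B.conjTranspose * B :=
    CStarAlgebra.nonneg_iff_eq_star_mul_self.1 hD.posSemidef.nonneg
  have hBu : IsUnit B.det := by
    have h := (Matrix.isUnit_iff_isUnit_det _).1 hD.isUnit
    rw [hB, Matrix.det_mul] at h
    exact isUnit_of_mul_isUnit_right h
  let comb : (s → ℂ) → Hil n := fun c => ∑ k, c k • stdVec k.1
  have hcomb : ∀ c (k : s), comb c k.1 = c k := fun c k => by
    rw [← inner_stdVec_left, inner_sum, Finset.sum_eq_single_of_mem k (Finset.mem_univ k)]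
    · rw [inner_smul_right, inner_stdVec_left, stdVec_apply_self, mul_one]
    · intro j _ hj
      rw [inner_smul_right, inner_stdVec_left, stdVec_apply_ne (fun h => hj (Subtype.ext h.symm)),
        mul_zero]
  have hcomb_inner : ∀ c η, inner ℂ (comb c) η = ∑ k, star (c k) * η k.1 := fun c η => by
    rw [sum_inner]
    refine Finset.sum_congr rfl fun k _ => ?_
    rw [inner_smul_left, inner_stdVec_left]
    rfl
  have hbi : ∀ j k, inner ℂ (comb fun l => star (B⁻¹ j l)) (comb fun l => B l k)
      = (1 : Matrix s s ℂ) j k := fun j k => by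
    rw [hcomb_inner, ← Matrix.nonsing_inv_mul _ hBu]
    simp [hcomb, Matrix.mul_apply]
  refine ⟨fun i => comb fun k => star (B⁻¹ i k), fun k => comb fun l => B l k, fun η => ?_, ?_, ?_,
    ?_⟩
  · have h1 : ∀ i, inner ℂ (comb fun k => star (B⁻¹ i k)) η = B⁻¹.mulVec (fun k => η k.1) i :=
      fun i => by
        rw [hcomb_inner]
        simp [Matrix.mulVec, dotProduct]
    simp only [h1]
    set c := B⁻¹.mulVec (fun k : s => η k.1) with hc
    have h2 : ∑ i, ∑ j, D i j * (star (c i) * c j) = star (B.mulVec c) ⬝ᵥ B.mulVec c := by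
      rw [Matrix.star_mulVec, Matrix.dotProduct_mulVec, Matrix.vecMul_vecMul, ← hB,
        ← Matrix.dotProduct_mulVec]
      simp only [dotProduct, Matrix.mulVec, Finset.mul_sum]
      refine Finset.sum_congr rfl fun i _ => Finset.sum_congr rfl fun j _ => ?_
      simp
      ring
    rw [h2, hc, Matrix.mulVec_mulVec, Matrix.mul_nonsing_inv _ hBu, Matrix.one_mulVec]
    refine le_trans (le_of_eq ?_) (sum_norm_sq_le s η)
    rw [dotProduct, Complex.re_sum, ← Finset.sum_coe_sort s]
    refine Finset.sum_congr rfl fun k _ => ?_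
    simp only [Pi.star_apply, RCLike.star_def, Complex.conj_mul']
    rw [← Complex.ofReal_pow, Complex.ofReal_re]
  · intro j
    rw [hbi, Matrix.one_apply_eq]
  · intro j k hjk
    rw [hbi, Matrix.one_apply_ne hjk]
  · rw [hB, Matrix.trace, Complex.re_sum]
    refine Finset.sum_congr rfl fun k _ => ?_
    rw [← Complex.ofReal_re (‖_‖ ^ 2)]
    congr 1
    have h := inner_self_eq_norm_sq_to_K (𝕜 := ℂ) (comb fun l => B l k)
    rw [hcomb_inner] at h
    simp only [hcomb] at h
    push_cast
    refine h.symm.trans ?_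
    simp [Matrix.mul_apply]

end Factorization

/-! ### Construction of the separating map -/

section Separation

variable {V : Type v} [NormedAddCommGroup V] [NormedSpace ℂ V] [OperatorSpace V]
  {κ : Cardinal.{u}} {K : ∀ I : Type u, Set (CBMatrix V I)} {n : Type u}

theorem adjoint_tensorRight_tensorRight {p : Type u} (w u : Hil n) (ξ : Hil p) :
    ContinuousLinearMap.adjoint (tensorRight p w) (tensorRight p u ξ) = inner ℂ w u • ξ := by
  ext k
  rw [adjoint_tensorRight_apply, tensorRight_apply, inner_smul_right, mul_comm]
  rfl

open scoped ComplexOrder in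
-- D may be singular, but B has to be inverted. The strict inequality at y leaves room in the trace
-- for adding ε1, and this only enlarges the dominating side.
theorem exists_dominating_posDef (hK : IsNCConvex κ K) (hκ : ℵ₀ ≤ κ)
    (h0 : (0 : CBMatrix V PUnit.{u + 1}) ∈ K PUnit.{u + 1}) [Nonempty n] (hn : #n ≤ κ)
    {s : Finset n} {v : s → s → V} (hv : ∀ x ∈ K n, (entrySum v x).re ≤ 1) {t : ℝ} (ht : 1 < t) :
    ∃ D : Matrix s s ℂ, D.PosDef ∧ D.trace.re < t ∧
      ∀ (p : Type u) [Nonempty p], #p ≤ κ → ∀ x ∈ K p, ∀ a : s → Hil p,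
        (∑ i, ∑ j, inner ℂ (a i) (x.toMap (v i j) (a j))).re
          ≤ (∑ i, ∑ j, D i j * inner ℂ (a i) (a j)).re := by
  classical
  obtain ⟨D, hD, hDt, hdom⟩ := exists_dominating_matrix hK hκ h0 hn hv
  obtain ⟨ε, hε, hεt⟩ : ∃ ε : ℝ, 0 < ε ∧ ε * Fintype.card s < t - 1 := by
    refine ⟨(t - 1) / (Fintype.card s + 1), by have := sub_pos.2 ht; positivity, ?_⟩
    rw [div_mul_eq_mul_div, div_lt_iff₀ (by positivity)]
    nlinarith
  refine ⟨D + (ε : ℂ) • 1, ?_, ?_, fun p _ hp x hx a => ?_⟩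
  · exact Matrix.PosDef.posSemidef_add hD
      (Matrix.PosDef.one.smul (by exact_mod_cast hε : (0 : ℂ) < (ε : ℂ)))
  · rw [Matrix.trace_add, Matrix.trace_smul, Matrix.trace_one, Complex.add_re, smul_eq_mul,
      Complex.re_ofReal_mul, Complex.natCast_re]
    linarith
  · refine (hdom p hp x hx a).trans ?_
    have h : ∑ i, ∑ j, (D + (ε : ℂ) • 1) i j * inner ℂ (a i) (a j)
        = ∑ i, ∑ j, D i j * inner ℂ (a i) (a j) + ∑ i, ((ε * ‖a i‖ ^ 2 : ℝ) : ℂ) := by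
      rw [← Finset.sum_add_distrib]
      refine Finset.sum_congr rfl fun i _ => ?_
      simp only [Matrix.add_apply, Matrix.smul_apply, add_mul, Finset.sum_add_distrib]
      congr 1
      rw [Finset.sum_eq_single_of_mem i (Finset.mem_univ i)]
      · rw [Matrix.one_apply_eq, inner_self_eq_norm_sq_to_K]
        push_cast
        simp
      · intro j _ hj
        rw [Matrix.one_apply_ne hj.symm]
        simp
    rw [h, Complex.add_re, ← Complex.ofReal_sum, Complex.ofReal_re]
    have : 0 ≤ ∑ i, ε * ‖a i‖ ^ 2 := Finset.sum_nonneg fun i _ => by positivity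
    linarith

/-- A pointwise estimate of a sesquilinear expression in `ζ k` sums up to one for `ζ`. -/
theorem re_sum_inner_adjoint_tensorRight_le {ι : Type*} [Fintype ι] {D : Matrix ι ι ℂ}
    {w : ι → Hil n}
    (hw : ∀ η : Hil n, (∑ i, ∑ j, D i j * (star (inner ℂ (w i) η) * inner ℂ (w j) η)).re
      ≤ ‖η‖ ^ 2) {p : Type u} (ζ : HilTensor p n) :
    (∑ i, ∑ j, D i j * inner ℂ (ContinuousLinearMap.adjoint (tensorRight p (w i)) ζ)
      (ContinuousLinearMap.adjoint (tensorRight p (w j)) ζ)).re ≤ ‖ζ‖ ^ 2 := by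
  have h1 : HasSum (fun k => ∑ i, ∑ j,
      D i j * (star (inner ℂ (w i) (ζ k)) * inner ℂ (w j) (ζ k)))
      (∑ i, ∑ j, D i j * inner ℂ (ContinuousLinearMap.adjoint (tensorRight p (w i)) ζ)
        (ContinuousLinearMap.adjoint (tensorRight p (w j)) ζ)) := by
    refine hasSum_sum fun i _ => hasSum_sum fun j _ => HasSum.mul_left _ ?_
    have h := lp.hasSum_inner (𝕜 := ℂ) (ContinuousLinearMap.adjoint (tensorRight p (w i)) ζ)
      (ContinuousLinearMap.adjoint (tensorRight p (w j)) ζ)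
    refine (congrArg (fun f => HasSum f _) (funext fun k => ?_)).mp h
    rw [adjoint_tensorRight_apply, adjoint_tensorRight_apply, RCLike.inner_apply, mul_comm]
    rfl
  have h2 : HasSum (fun k => ‖ζ k‖ ^ 2) (‖ζ‖ ^ 2) := by
    have h := lp.hasSum_norm (p := 2) (by norm_num) ζ
    simpa using h
  exact hasSum_le (fun k => hw (ζ k)) (Complex.hasSum_re h1) h2

theorem exists_separates_finiteRankMap (hK : IsNCConvex κ K) (hκ : ℵ₀ ≤ κ)
    (h0 : (0 : CBMatrix V PUnit.{u + 1}) ∈ K PUnit.{u + 1}) [Nonempty n] (hn : #n ≤ κ)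
    {s : Finset n} {v : s → s → V} (hv : ∀ x ∈ K n, (entrySum v x).re ≤ 1) {y : CBMatrix V n}
    (hy : 1 < (entrySum v y).re) : ∃ w : s → Hil n, Separates κ K y (finiteRankMap v w) := by
  obtain ⟨D, hD, hDt, hdom⟩ := exists_dominating_posDef hK hκ h0 hn hv hy
  obtain ⟨w, u, hw, hwu, hwu', hu⟩ := exists_biorthogonal_of_posDef hD
  refine ⟨w, isNormalMap_finiteRankMap v w, completelyBounded_finiteRankMap v w,
    fun p _ hp x hx => ⟨_, isAmplification_finiteRank v w x, ?_⟩,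
    _, isAmplification_finiteRank v w y, ?_⟩
  · rw [realPart_le_one_iff]
    intro ζ
    rw [inner_finiteRankAmplification]
    exact (hdom p hp x hx _).trans (re_sum_inner_adjoint_tensorRight_le hw ζ)
  -- The violating vector is ζ = ∑ e_k ⊗ u_k: biorthogonality slices it back to the e_j, and its
  -- squared norm is tr D, which is below the value at y.
  · rw [realPart_le_one_iff]
    push Not
    let ζ : HilTensor n n := ∑ k : s, tensorRight n (u k) (stdVec k.1)
    have hζ : ∀ j, ContinuousLinearMap.adjoint (tensorRight n (w j)) ζ = stdVec j.1 := fun j => by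
      simp only [ζ, map_sum, adjoint_tensorRight_tensorRight]
      rw [Finset.sum_eq_single_of_mem j (Finset.mem_univ j), hwu, one_smul]
      intro k _ hk
      rw [hwu' j k hk.symm, zero_smul]
    refine ⟨ζ, ?_⟩
    rw [inner_finiteRankAmplification]
    simp only [hζ]
    refine lt_of_eq_of_lt ?_ hDt
    rw [← hu, ← Complex.ofReal_re (‖ζ‖ ^ 2), ← Complex.ofReal_re (∑ k, ‖u k‖ ^ 2)]
    congr 1
    push_cast
    refine (inner_self_eq_norm_sq_to_K (𝕜 := ℂ) ζ).symm.trans ?_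
    conv_lhs => rw [show ζ = ∑ k : s, tensorRight n (u k) (stdVec k.1) from rfl, sum_inner]
    refine Finset.sum_congr rfl fun k _ => ?_
    rw [inner_sum, Finset.sum_eq_single_of_mem k (Finset.mem_univ k),
      ← ContinuousLinearMap.adjoint_inner_right, adjoint_tensorRight_tensorRight, inner_smul_right,
      inner_stdVec_left, stdVec_apply_self, mul_one]
    · exact inner_self_eq_norm_sq_to_K (𝕜 := ℂ) (u k)
    · intro l _ hl
      rw [← ContinuousLinearMap.adjoint_inner_right, adjoint_tensorRight_tensorRight,
        inner_smul_right, inner_stdVec_left,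
        stdVec_apply_ne (fun h => hl (Subtype.ext h.symm)), mul_zero]

end Separation

/-! ### Recognising predual elements in the bidual -/

section DoubleDual

variable {V : Type v} [NormedAddCommGroup V] [NormedSpace ℂ V]

/-- A functional on `V*` which on the unit ball is small on subspaces `⋂ ker ev_v` of finite
codimension belongs to `V`. -/
theorem exists_eq_eval_of_small_on_ball [CompleteSpace V] (g : StrongDual ℂ (StrongDual ℂ V))
    (hg : ∀ ε : ℝ, 0 < ε → ∃ F : Finset V, ∀ f : StrongDual ℂ V, ‖f‖ ≤ 1 → (∀ v ∈ F, f v = 0) →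
      ‖g f‖ ≤ ε) : ∃ v, ∀ f : StrongDual ℂ V, g f = f v := by
  let J := NormedSpace.inclusionInDoubleDualLi (E := V) ℂ
  suffices h : g ∈ Set.range J by
    obtain ⟨v, rfl⟩ := h
    exact ⟨v, fun f => rfl⟩
  rw [← J.isometry.isClosedEmbedding.isClosed_range.closure_eq, Metric.mem_closure_iff]
  intro ε hε
  obtain ⟨F, hF⟩ := hg (ε / 2) (half_pos hε)
  let L : F → StrongDual ℂ V →ₗ[ℂ] ℂ := fun v => (J v.1 : StrongDual ℂ V →ₗ[ℂ] ℂ)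
  let M : Submodule ℂ (StrongDual ℂ V) := ⨅ v, LinearMap.ker (L v)
  have hM : ∀ f ∈ M, ∀ v ∈ F, f v = 0 := fun f hf v hv => (Submodule.mem_iInf _).1 hf ⟨v, hv⟩
  -- A norm-preserving extension g' of the restriction of g to M has norm at most ε/2, and g - g'
  -- vanishes on M, hence is a combination of evaluations. So g is within ε of the image of V, which
  -- is closed by completeness.
  obtain ⟨g', hg', hnorm⟩ := exists_extension_norm_eq M (g.comp M.subtypeL)
  have hle : ‖g'‖ ≤ ε / 2 := by
    rw [hnorm]
    exact ContinuousLinearMap.opNorm_le_of_unit_norm (half_pos hε).le fun f hf =>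
      hF f.1 hf.le (hM f.1 f.2)
  have hspan : ((g - g' : StrongDual ℂ (StrongDual ℂ V)) : StrongDual ℂ V →ₗ[ℂ] ℂ) ∈
      Submodule.span ℂ (Set.range L) := by
    refine mem_span_of_iInf_ker_le_ker fun f hf => ?_
    have := hg' ⟨f, hf⟩
    change g f - g' f = 0
    rw [sub_eq_zero]
    exact this.symm
  obtain ⟨c, hc⟩ := (Submodule.mem_span_range_iff_exists_fun ℂ).1 hspan
  refine ⟨J (∑ v, c v • v.1), ⟨_, rfl⟩, ?_⟩
  have : J (∑ v, c v • v.1) = g - g' := by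
    ext f
    have h := LinearMap.congr_fun hc f
    change f (∑ v, c v • v.1) = g f - g' f
    rw [map_sum]
    refine Eq.trans ?_ h
    rw [LinearMap.sum_apply]
    exact Finset.sum_congr rfl fun v _ => map_smul f _ _
  have h2 : g - (g - g') = g' := by
    ext f
    exact sub_sub_cancel (g f) (g' f)
  rw [this, dist_eq_norm, h2]
  exact hle.trans_lt (half_lt_self hε)

end DoubleDual

/-! ### A norm characterisation of self-adjoint elements -/

section SelfAdjoint

variable {A : Type w} [CStarAlgebra A]

theorem norm_add_I_smul_one_sq_le {a : A} (ha : IsSelfAdjoint a) {C : ℝ} (hC : ‖a‖ ≤ C) (t : ℝ) :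
    ‖a + (t * Complex.I) • (1 : A)‖ ^ 2 ≤ C ^ 2 + t ^ 2 := by
  rcases subsingleton_or_nontrivial A with h | h
  · rw [Subsingleton.elim (a + _) 0, norm_zero, zero_pow two_ne_zero]
    positivity
  have h1 : star (a + (t * Complex.I) • (1 : A)) * (a + (t * Complex.I) • (1 : A))
      = a * a + ((t ^ 2 : ℝ) : ℂ) • (1 : A) := by
    simp only [star_add, star_smul, star_one, ha.star_eq, add_mul, mul_add, smul_mul_assoc, one_mul,
      mul_smul_comm, mul_one]
    have h2 : (star ((t : ℂ) * Complex.I) * (t * Complex.I)) = ((t ^ 2 : ℝ) : ℂ) := by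
      have := Complex.I_mul_I
      simp
      linear_combination (-(t : ℂ) ^ 2) * this
    have h3 : star ((t : ℂ) * Complex.I) = -(t * Complex.I) := by simp
    rw [← h2, h3]
    module
  rw [pow_two, ← CStarRing.norm_star_mul_self, h1]
  refine (norm_add_le _ _).trans (add_le_add ((norm_mul_le _ _).trans ?_) ?_)
  · rw [pow_two]
    exact mul_le_mul hC hC (norm_nonneg _) ((norm_nonneg _).trans hC)
  · rw [norm_smul, CStarRing.norm_one, mul_one, Complex.norm_real, Real.norm_of_nonneg (sq_nonneg t)]

/-- Taking imaginary parts is contractive and turns a + it1 into b + t1. A spectral value l of b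
thus satisfies (l + t)² ≤ C + t² for all real t; this bounds 2lt above and forces l = 0. -/
theorem isSelfAdjoint_of_norm_add_I_smul_one_sq_le [PartialOrder A] [StarOrderedRing A] {a : A}
    {C : ℝ} (h : ∀ t : ℝ, ‖a + (t * Complex.I) • (1 : A)‖ ^ 2 ≤ C + t ^ 2) :
    IsSelfAdjoint a := by
  rcases subsingleton_or_nontrivial A with hA | hA
  · exact Subsingleton.elim _ _
  let b : A := imaginaryPart a
  have hb : IsSelfAdjoint b := (imaginaryPart a).2
  have hbt : ∀ t : ℝ, ‖b + algebraMap ℝ A t‖ ^ 2 ≤ C + t ^ 2 := fun t => by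
    refine le_trans ?_ (h t)
    gcongr
    have h1 : b + algebraMap ℝ A t = imaginaryPart (a + (t * Complex.I) • (1 : A)) := by
      rw [map_add, AddSubgroup.coe_add]
      congr 1
      rw [imaginaryPart_smul, IsSelfAdjoint.imaginaryPart (IsSelfAdjoint.one A), smul_zero, zero_add,
        selfAdjoint.val_smul, (IsSelfAdjoint.one A).coe_realPart]
      simp [Algebra.algebraMap_eq_smul_one]
    rw [h1]
    exact imaginaryPart.norm_le (a + (t * Complex.I) • (1 : A))
  have key : ∀ l : ℝ, l ∈ spectrum ℝ b → l = 0 := fun l hl => by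
    have h2 : ∀ t : ℝ, (l + t) ^ 2 ≤ C + t ^ 2 := fun t => by
      refine le_trans ?_ (hbt t)
      rw [← sq_abs, ← Real.norm_eq_abs]
      gcongr
      refine spectrum.norm_le_norm_of_mem ?_
      rwa [add_comm b, spectrum.add_mem_add_iff]
    by_contra hl0
    -- For this t the cross term 2lt equals C, leaving l² ≤ 0.
    have h3 := h2 (C / (2 * l))
    have h4 : 2 * l * (C / (2 * l)) = C := by field_simp
    nlinarith [sq_pos_of_ne_zero hl0]
  have hb0 : b = 0 := by
    rw [← norm_eq_zero]
    rcases CStarAlgebra.norm_or_neg_norm_mem_spectrum hb with h | h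
    · exact key _ h
    · exact neg_eq_zero.1 (key _ h)
  rw [← realPart_add_I_smul_imaginaryPart a, show (imaginaryPart a : A) = 0 from hb0, smul_zero, add_zero]
  exact (realPart a).2

end SelfAdjoint

theorem norm_starAlgEquiv_apply {A B : Type*} [CStarAlgebra A] [CStarAlgebra B] (φ : A ≃⋆ₐ[ℂ] B)
    (a : A) : ‖φ a‖ = ‖a‖ :=
  StarAlgEquiv.norm_map φ a

/-! ### Weak* continuity of the involution -/

namespace OperatorSystemOn

variable {A : Type w} [CStarAlgebra A] [PartialOrder A] [StarOrderedRing A]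
  {V : Type v} [NormedAddCommGroup V] [NormedSpace ℂ V] [OperatorSpace V]
  (S : OperatorSystemOn A V)

theorem norm_iso (a : S.carrier) : ‖S.iso a‖ = ‖(a : A)‖ := by
  have h := S.completeIsometry 1 (fun _ _ => a)
  have h1 : Matrix.map (m := Fin 1) (n := Fin 1) (fun _ _ => a) S.iso = fun _ _ => S.iso a := rfl
  rw [h1, dualMatrixNorm_one] at h
  rw [h]
  exact norm_starAlgEquiv_apply (B := CStarMatrix (Fin 1) (Fin 1) A)
    (CStarMatrix.toOneByOne (Fin 1) ℂ A) (a : A)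

theorem coe_iso_symm_adj (e : StrongDual ℂ V) :
    (S.iso.symm (S.adj e) : A) = star (S.iso.symm e : A) := by
  rw [adj, LinearEquiv.symm_apply_apply]

theorem adj_eq_iff {e f : StrongDual ℂ V} :
    S.adj e = f ↔ star (S.iso.symm e : A) = (S.iso.symm f : A) := by
  rw [← coe_iso_symm_adj, Subtype.coe_inj, S.iso.symm.injective.eq_iff]

theorem adj_adj (e : StrongDual ℂ V) : S.adj (S.adj e) = e := by
  rw [adj_eq_iff, coe_iso_symm_adj, star_star]

theorem adj_add (e f : StrongDual ℂ V) : S.adj (e + f) = S.adj e + S.adj f := by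
  rw [adj_eq_iff, map_add, map_add, Submodule.coe_add, Submodule.coe_add, coe_iso_symm_adj,
    coe_iso_symm_adj, star_add]

theorem adj_smul (c : ℂ) (e : StrongDual ℂ V) : S.adj (c • e) = star c • S.adj e := by
  rw [adj_eq_iff, map_smul, map_smul, Submodule.coe_smul, Submodule.coe_smul, coe_iso_symm_adj,
    star_smul]

theorem norm_coe_iso_symm (e : StrongDual ℂ V) : ‖(S.iso.symm e : A)‖ = ‖e‖ := by
  rw [← S.norm_iso, LinearEquiv.apply_symm_apply]

theorem norm_adj (e : StrongDual ℂ V) : ‖S.adj e‖ = ‖e‖ := by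
  rw [← S.norm_coe_iso_symm, coe_iso_symm_adj, norm_star, S.norm_coe_iso_symm]

theorem norm_add_I_smul_unit (e : StrongDual ℂ V) (t : ℝ) :
    ‖e + (t * Complex.I) • S.iso ⟨1, S.one_mem⟩‖
      = ‖(S.iso.symm e : A) + (t * Complex.I) • (1 : A)‖ := by
  rw [← S.norm_coe_iso_symm, map_add, map_smul, LinearEquiv.symm_apply_apply]
  rfl

/-- The adjoint on the unit ball has a weak* closed graph, hence it is weak* continuous. -/
theorem exists_adj_apply_small (v : V) {ε : ℝ} (hε : 0 < ε) :
    ∃ F : Finset V, ∀ e : StrongDual ℂ V, ‖e‖ ≤ 1 → (∀ w ∈ F, e w = 0) → ‖S.adj e v‖ ≤ ε := by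
  let U : WeakDual ℂ V := StrongDual.toWeakDual (S.iso ⟨1, S.one_mem⟩)
  let B : Set (WeakDual ℂ V) := WeakDual.toStrongDual ⁻¹' Metric.closedBall 0 1
  have hB : IsCompact B := WeakDual.isCompact_closedBall 0 1
  -- R consists of the self-adjoint elements of norm at most 2, written as an intersection of weak*
  -- closed conditions. The constant 2 bounds e + e^* and i(e - e^*) for e in the unit ball.
  let R : Set (WeakDual ℂ V) := ⋂ t : ℝ, (fun e => e + (t * Complex.I) • U) ⁻¹'
    (WeakDual.toStrongDual ⁻¹' Metric.closedBall 0 (√(2 ^ 2 + t ^ 2)))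
  have hR : IsClosed R := isClosed_iInter fun t =>
    (WeakDual.isClosed_closedBall 0 _).preimage (continuous_id.add continuous_const)
  have hRmem : ∀ e : StrongDual ℂ V, StrongDual.toWeakDual e ∈ R ↔
      ∀ t : ℝ, ‖(S.iso.symm e : A) + (t * Complex.I) • (1 : A)‖ ^ 2 ≤ 2 ^ 2 + t ^ 2 := fun e => by
    simp only [R, Set.mem_iInter]
    refine forall_congr' fun t => ?_
    rw [← norm_add_I_smul_unit, ← Real.le_sqrt (norm_nonneg _) (by positivity)]
    exact mem_closedBall_zero_iff
  -- Membership of q.1 + q.2 and i(q.1 - q.2) in R says q.2 = q.1^*. C is thus the compact part of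
  -- the graph of the involution over the ball where |q.2(v)| ≥ ε. It has no point with q.1 = 0, so
  -- finitely many conditions q.1(w) = 0 already exclude it.
  let C : Set (WeakDual ℂ V × WeakDual ℂ V) := (B ×ˢ B) ∩ ({q | ε ≤ ‖q.2 v‖} ∩
    ((fun q => q.1 + q.2) ⁻¹' R ∩ (fun q => Complex.I • (q.1 - q.2)) ⁻¹' R))
  have hC : IsCompact C := by
    refine (hB.prod hB).inter_right (IsClosed.inter ?_ (IsClosed.inter ?_ ?_))
    · exact isClosed_le continuous_const ((WeakDual.eval_continuous v).comp continuous_snd).norm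
    · exact hR.preimage (continuous_fst.add continuous_snd)
    · exact hR.preimage ((continuous_fst.sub continuous_snd).const_smul Complex.I)
  obtain ⟨F, hF⟩ := hC.elim_finite_subfamily_closed (fun w : V => {q | q.1 w = 0})
    (fun w => isClosed_eq ((WeakDual.eval_continuous w).comp continuous_fst) continuous_const) (by
      refine Set.eq_empty_of_forall_notMem fun q ⟨⟨_, hq, hq1, hq2⟩, hq0⟩ => ?_
      have h0 : q.1 = 0 := by
        exact DFunLike.ext _ _ fun w => Set.mem_iInter.1 hq0 w
      have h1 := isSelfAdjoint_of_norm_add_I_smul_one_sq_le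
        ((hRmem (WeakDual.toStrongDual q.2)).1 (by simpa [h0] using hq1))
      have h2 := isSelfAdjoint_of_norm_add_I_smul_one_sq_le
        ((hRmem (Complex.I • (0 - WeakDual.toStrongDual q.2))).1 (by simpa [h0] using hq2))
      rw [zero_sub, smul_neg, map_neg, map_smul, Submodule.coe_neg, Submodule.coe_smul,
        IsSelfAdjoint, star_neg, star_smul, h1.star_eq, RCLike.star_def, Complex.conj_I, neg_smul,
        neg_neg, eq_neg_iff_add_eq_zero, ← two_smul ℂ,
        smul_eq_zero_iff_right (two_ne_zero (α := ℂ)), smul_eq_zero_iff_right Complex.I_ne_zero, Submodule.coe_eq_zero,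
        LinearEquiv.map_eq_zero_iff] at h2
      have h3 : ‖q.2 v‖ = 0 := by
        rw [show q.2 = 0 from h2]
        exact norm_zero
      exact (hε.trans_le hq).ne' h3)
  refine ⟨F, fun e he hF0 => ?_⟩
  by_contra! hlt
  have h : ((StrongDual.toWeakDual e, StrongDual.toWeakDual (S.adj e)) :
      WeakDual ℂ V × WeakDual ℂ V) ∈ C ∩ ⋂ w ∈ F, {q | q.1 w = 0} := by
    have he' : ‖S.adj e‖ ≤ 1 := (S.norm_adj e).trans_le he
    refine ⟨⟨⟨mem_closedBall_zero_iff.2 he, mem_closedBall_zero_iff.2 he'⟩, hlt.le, ?_, ?_⟩,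
      Set.mem_iInter₂.2 hF0⟩
    · refine (hRmem (e + S.adj e)).2 fun t => norm_add_I_smul_one_sq_le ?_ ?_ t
      · rw [map_add, Submodule.coe_add, coe_iso_symm_adj]
        exact IsSelfAdjoint.add_star_self _
      · rw [norm_coe_iso_symm]
        exact (norm_add_le _ _).trans (by linarith)
    · refine (hRmem (Complex.I • (e - S.adj e))).2 fun t => norm_add_I_smul_one_sq_le ?_ ?_ t
      · rw [map_smul, map_sub, Submodule.coe_smul, Submodule.coe_sub, coe_iso_symm_adj, IsSelfAdjoint,
          star_smul, star_sub, star_star, RCLike.star_def, Complex.conj_I]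
        module
      · rw [norm_coe_iso_symm, norm_smul, Complex.norm_I, one_mul]
        exact (norm_sub_le _ _).trans (by linarith)
  rw [hF] at h
  exact h

/-- The adjoint on `V*` is the dual of an adjoint on `V`. -/
theorem exists_predual_adj [CompleteSpace V] (v : V) :
    ∃ v' : V, ∀ e : StrongDual ℂ V, e v' = star (S.adj e v) := by
  -- The outer conjugation compensates for the conjugate linearity of the involution.
  let g : StrongDual ℂ (StrongDual ℂ V) := LinearMap.mkContinuous
    { toFun := fun e => star (S.adj e v)
      map_add' := fun e f => by rw [adj_add, add_apply, star_add]
      map_smul' := fun c e => by rw [adj_smul, smul_apply, star_smul, star_star]; rfl } ‖v‖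
    fun e => by
      change ‖star (S.adj e v)‖ ≤ _
      rw [norm_star, ← S.norm_adj e, mul_comm]
      exact (S.adj e).le_opNorm v
  obtain ⟨v', hv'⟩ := exists_eq_eval_of_small_on_ball g fun ε hε => by
    obtain ⟨F, hF⟩ := S.exists_adj_apply_small v hε
    exact ⟨F, fun f h1 h2 => (norm_star _).trans_le (hF f h1 h2)⟩
  exact ⟨v', fun e => (hv' e).symm⟩

end OperatorSystemOn

/-! ### Symmetrization and the self-adjoint case -/

namespace OperatorSystemOn

variable {A : Type w} [CStarAlgebra A] [PartialOrder A] [StarOrderedRing A]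
  {V : Type v} [NormedAddCommGroup V] [NormedSpace ℂ V] [OperatorSpace V]
  (S : OperatorSystemOn A V)

/-- A matrix over the predual can be replaced by its real part without changing the real part of
its pairing with self-adjoint matrices. -/
theorem exists_symmetrized [CompleteSpace V] {n : Type u} {s : Finset n} (v : s → s → V) :
    ∃ v' : s → s → V, (∀ i j e, S.adj e (v' j i) = star (e (v' i j))) ∧
      ∀ x : CBMatrix V n, S.IsSelfAdjointMatrix x →
        (entrySum v' x).re = (entrySum v x).re := by
  choose d hd using S.exists_predual_adj
  -- The hermitian part of v. Against a self-adjoint x, the matrix with entries d(v_ji) pairs to the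
  -- conjugate of the pairing with v, so the average has the same real part.
  refine ⟨fun i j => (2⁻¹ : ℂ) • (v i j + d (v j i)), fun i j e => ?_, fun x hx => ?_⟩
  · rw [map_smul, map_smul, map_add, map_add, hd, hd, adj_adj, smul_eq_mul, smul_eq_mul, star_mul',
      star_add, star_star, add_comm]
    simp
  · have h : ∑ i, ∑ j, x.entry i.1 j.1 (d (v j i)) = star (entrySum v x) := by
      rw [entrySum, star_sum, Finset.sum_comm]
      refine Finset.sum_congr rfl fun j _ => ?_
      rw [star_sum]
      refine Finset.sum_congr rfl fun i _ => ?_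
      rw [hd, ← hx j i]
    have h2 : entrySum (fun i j => (2⁻¹ : ℂ) • (v i j + d (v j i))) x
        = 2⁻¹ * (entrySum v x + star (entrySum v x)) := by
      rw [← h]
      simp only [entrySum, map_smul, map_add, smul_eq_mul, ← Finset.mul_sum, Finset.sum_add_distrib]
    rw [h2, RCLike.star_def, Complex.add_conj, Complex.ofReal_mul, Complex.ofReal_ofNat,
      inv_mul_cancel_left₀ two_ne_zero]
    exact Complex.ofReal_re _

theorem isSelfAdjointMap_finiteRankMap {n : Type u} {ι : Type*} [Fintype ι] {v : ι → ι → V}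
    (hv : ∀ i j e, S.adj e (v j i) = star (e (v i j))) (w : ι → Hil n) :
    S.IsSelfAdjointMap (finiteRankMap v w) := by
  intro e
  rw [finiteRankMap_apply, finiteRankMap_apply, star_sum, Finset.sum_comm]
  refine Finset.sum_congr rfl fun j _ => ?_
  rw [star_sum]
  refine Finset.sum_congr rfl fun i _ => ?_
  rw [star_smul, hv, star_star, ContinuousLinearMap.star_eq_adjoint, adjoint_rankOne]

end OperatorSystemOn

theorem mainTheorem8 {V : Type v} [NormedAddCommGroup V] [NormedSpace ℂ V] [CompleteSpace V]
    [OperatorSpace V] (κ : Cardinal.{u}) (hκ : ℵ₀ ≤ κ)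
    (K : ∀ I : Type u, Set (CBMatrix V I)) (hK : IsNCConvex κ K) (hKc : IsNCClosed κ K)
    (h0 : (0 : CBMatrix V PUnit.{u + 1}) ∈ K PUnit.{u + 1})
    (n : Type u) [Nonempty n] (hn : #n ≤ κ) (y : CBMatrix V n) (hy : y ∉ K n) :
    (∃ φ : StrongDual ℂ V →ₗ[ℂ] MM n, Separates κ K y φ) ∧
      ∀ (A : Type w) [CStarAlgebra A] [PartialOrder A] [StarOrderedRing A]
        (S : OperatorSystemOn A V),
        (∀ (p : Type u) [Nonempty p], #p ≤ κ → ∀ x ∈ K p, S.IsSelfAdjointMatrix x) →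
        S.IsSelfAdjointMatrix y →
        ∃ φ : StrongDual ℂ V →ₗ[ℂ] MM n, Separates κ K y φ ∧ S.IsSelfAdjointMap φ := by
  obtain ⟨s, v, hv, hvy⟩ := exists_separating_functional hκ hK hKc h0 n hn y hy
  refine ⟨?_, fun A _ _ _ S hSK hSy => ?_⟩
  · obtain ⟨w, hw⟩ := exists_separates_finiteRankMap hK hκ h0 hn hv hvy
    exact ⟨_, hw⟩
  -- Since K_n and y are self-adjoint, v can be symmetrized before the domination argument without
  -- changing any of the inequalities.
  · obtain ⟨v', hv', hv'x⟩ := S.exists_symmetrized v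
    obtain ⟨w, hw⟩ := exists_separates_finiteRankMap hK hκ h0 hn
      (fun x hx => (hv'x x (hSK n hn x hx)).trans_le (hv x hx)) ((hv'x y hSy).symm ▸ hvy)
    exact ⟨_, hw, S.isSelfAdjointMap_finiteRankMap hv' w⟩
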